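/- **Setting.** *Language.* Dimension terms $r$ are $0$, $1$ or one of countably many dimension names $x,y,\dots$; $\varepsilon$ ranges over $\{0,1\}$ and $\bar\varepsilon=1-\varepsilon$. Terms, up to renaming of bound variables, are $$(a{:}A)\to B,\ (a{:}A)\times B,\ \mathsf{Id}_{x.A}(M,N),\ \mathsf{bool},\ \mathsf{not}_r,\ \mathbb S^1,\ \lambda a.M,\ MN,\ \langle M,N\rangle,\ \mathsf{fst}\,M,\ \mathsf{snd}\,M,\ \langle x\rangle M,\ M@r,\ \mathsf{true},\ \mathsf{false},\ \mathsf{if}_{a.A}(M;T,F),\ \mathsf{notel}_r(M),\ \mathsf{base},\ \mathsf{loop}_r,\ \mathbb S^1\text{-}\mathsf{elim}_{a.A}(M;P,x.L),$$ together with variables $a$, coercion $\mathsf{coe}_{x.A}^{r\rightsquigarrow r'}(M)$ and homogeneous composition $\mathsf{hcom}_A^{r_1,\dots,r_n}(r\rightsquigarrow r',M;\overrightarrow{y.N_i^\varepsilon})$ with $n\ge1$, cap $M$ and $2n$ tube faces. Put $\mathsf{com}^{\vec r_i}_{y.A}(r\rightsquigarrow r',M;\overrightarrow{y.N_i^\varepsilon}):=\mathsf{hcom}^{\vec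 r_i}_{A\langle r'/y\rangle}(r\rightsquigarrow r',\mathsf{coe}_{y.A}^{r\rightsquigarrow r'}(M);\overrightarrow{y.\mathsf{coe}_{y.A}^{y\rightsquigarrow r'}(N_i^\varepsilon)})$ and $\mathsf{not}(M):=\mathsf{if}_{\_.\mathsf{bool}}(M;\mathsf{false},\mathsf{true})$. *Evaluation.* Values are $(a{:}A)\to B$, $(a{:}A)\times B$, $\mathsf{Id}_{x.A}(M,N)$, $\mathsf{bool}$, $\mathsf{not}_x$, $\mathbb S^1$, $\lambda a.M$, $\langle M,N\rangle$, $\langle x\rangle M$, $\mathsf{true}$, $\mathsf{false}$, $\mathsf{base}$, $\mathsf{loop}_x$, $\mathsf{notel}_x(M)$ and, for $C\in\{\mathsf{bool},\mathbb S^1\}$ and $r\ne r'$, $\mathsf{hcom}_C^{x_1,\dots,x_n}(r\rightsquigarrow r',M;\overrightarrow{y.N_i^\varepsilon})$ with all extents names. One-step evaluation $\longmapsto$, on terms without free term variables, evaluates principal arguments: the function in $MN$, the argument of $\mathsf{fst},\mathsf{snd}$, $M$ in $M@r$, $\mathsf{if}$ and $\mathbb S^1$-$\mathsf{elim}$, the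 type of $\mathsf{hcom}$ and $\mathsf{coe}$, and $M$ in $\mathsf{coe}_{x.\mathsf{not}_x}^{z\rightsquigarrow r}(M)$ for a name $z$. The remaining rules are as follows, where $h^{s}$ abbreviates $\mathsf{hcom}_C^{\vec r_i}(r\rightsquigarrow s,M;\overrightarrow{y.N_i^\varepsilon})$ for the $C$ in question, $h=h^{r'}$, and $w,z$ are names. - $C=\mathsf{bool}$ or $\mathbb S^1$: $h\longmapsto N_i^\varepsilon\langle r'/y\rangle$ if $r_i=\varepsilon$ and $r_1,\dots,r_{i-1}$ are names; $h\longmapsto M$ if all $r_i$ are names and $r=r'$; $\mathsf{coe}_{x.C}^{r\rightsquigarrow r'}(M)\longmapsto M$. - $\mathsf{if}_{a.A}(\mathsf{true};T,F)\longmapsto T$; $\mathsf{if}_{a.A}(\mathsf{false};T,F)\longmapsto F$; for $C=\mathsf{bool}$, all $r_i$ names and $r\neq r'$, $\mathsf{if}_{a.A}(h;T,F)\longmapsto\mathsf{com}^{\vec r_i}_{z.A[h^{z}/a]}(r\rightsquigarrow r',\mathsf{if}_{a.A}(M;T,F);\overrightarrow{y.\mathsf{if}_{a.A}(N_i^\varepsilon;T,F)})$.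 - $\mathsf{loop}_\varepsilon\longmapsto\mathsf{base}$; $\mathbb S^1$-$\mathsf{elim}_{a.A}(\mathsf{base};P,x.L)\longmapsto P$; $\mathbb S^1$-$\mathsf{elim}_{a.A}(\mathsf{loop}_w;P,x.L)\longmapsto L\langle w/x\rangle$; on composition values of $\mathbb S^1$ as for $\mathsf{if}$. - $(\lambda a.M)N\longmapsto M[N/a]$; $\mathsf{fst}\langle M,N\rangle\longmapsto M$; $\mathsf{snd}\langle M,N\rangle\longmapsto N$; $(\langle x\rangle M)@r\longmapsto M\langle r/x\rangle$. - $C=(a{:}A)\to B$: $h\longmapsto\lambda a.\mathsf{hcom}^{\vec r_i}_B(r\rightsquigarrow r',Ma;\overrightarrow{y.N_i^\varepsilon a})$; $\mathsf{coe}_{x.C}^{r\rightsquigarrow r'}(M)\longmapsto\lambda a.\mathsf{coe}_{x.B[\mathsf{coe}_{x.A}^{r'\rightsquigarrow x}(a)/a]}^{r\rightsquigarrow r'}(M\,\mathsf{coe}_{x.A}^{r'\rightsquigarrow r}(a))$. - $C=(a{:}A)\times B$: $h\longmapsto\langle G^{r'},\mathsf{com}^{\vec r_i}_{z.B[G^z/a]}(r\rightsquigarrow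 r',\mathsf{snd}\,M;\overrightarrow{y.\mathsf{snd}\,N_i^\varepsilon})\rangle$ with $G^s=\mathsf{hcom}_A^{\vec r_i}(r\rightsquigarrow s,\mathsf{fst}\,M;\overrightarrow{y.\mathsf{fst}\,N_i^\varepsilon})$; $\mathsf{coe}_{x.C}^{r\rightsquigarrow r'}(M)\longmapsto\langle\mathsf{coe}_{x.A}^{r\rightsquigarrow r'}(\mathsf{fst}\,M),\mathsf{coe}_{x.B[\mathsf{coe}_{x.A}^{r\rightsquigarrow x}(\mathsf{fst}\,M)/a]}^{r\rightsquigarrow r'}(\mathsf{snd}\,M)\rangle$. - $C=\mathsf{Id}_{x.A}(P_0,P_1)$: $h\longmapsto\langle x\rangle\mathsf{hcom}_A^{\vec r_i,x}(r\rightsquigarrow r',M@x;\overrightarrow{y.N_i^\varepsilon@x},\_.P_0,\_.P_1)$; $\mathsf{coe}_{y.C}^{r\rightsquigarrow r'}(M)\longmapsto\langle x\rangle\mathsf{com}^x_{y.A}(r\rightsquigarrow r',M@x;y.P_0,y.P_1)$. - $\mathsf{not}_\varepsilon\longmapsto\mathsf{bool}$; $\mathsf{notel}_0(M)\longmapsto\mathsf{not}(M)$;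 $\mathsf{notel}_1(M)\longmapsto M$; $\mathsf{coe}_{x.\mathsf{not}_x}^{\varepsilon\rightsquigarrow\bar\varepsilon}(M)\longmapsto\mathsf{not}(M)$; $\mathsf{coe}_{x.\mathsf{not}_x}^{\varepsilon\rightsquigarrow\varepsilon}(M)\longmapsto M$; $\mathsf{coe}_{x.\mathsf{not}_x}^{0\rightsquigarrow z}(M)\longmapsto\mathsf{notel}_z(\mathsf{not}(M))$; $\mathsf{coe}_{x.\mathsf{not}_x}^{1\rightsquigarrow z}(M)\longmapsto\mathsf{notel}_z(M)$; $\mathsf{coe}_{x.\mathsf{not}_x}^{z\rightsquigarrow r}(\mathsf{notel}_z(M))\longmapsto\mathsf{notel}_r(M)$; $\mathsf{coe}_{x.\mathsf{not}_w}^{r\rightsquigarrow r'}(M)\longmapsto M$ for $w\ne x$; and, for $C=\mathsf{not}_w$, $h\longmapsto\mathsf{notel}_w(\mathsf{hcom}^{\vec r_i}_{\mathsf{bool}}(r\rightsquigarrow r',\mathsf{coe}^{w\rightsquigarrow1}_{x.\mathsf{not}_x}(M);\overrightarrow{y.\mathsf{coe}^{w\rightsquigarrow1}_{x.\mathsf{not}_x}(N_i^\varepsilon)}))$.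 $M\Downarrow V$ means $M\longmapsto^*V$ and $V$ is a value. *Judgments.* A dimension context $\Psi$ is a finite set of names; $\psi:\Psi'\to\Psi$ assigns to each name of $\Psi$ a dimension term over $\Psi'$; $M\psi$ is the substituted term. A *cubical type system* gives for every $\Psi$ a symmetric transitive relation $A\approx B\ [\Psi]$ on values over $\Psi$ and, whenever $A\approx B\ [\Psi]$, the same symmetric transitive relation $M\approx_AN\ [\Psi]$ and $M\approx_BN\ [\Psi]$ on values over $\Psi$. Fix one. - $A\doteq B\ \mathsf{pretype}\ [\Psi]$: for all $\psi_1:\Psi_1\to\Psi$, $\psi_2:\Psi_2\to\Psi_1$ there are values with $A\psi_1\Downarrow A_1$, $A_1\psi_2\Downarrow A_2$, $A\psi_1\psi_2\Downarrow A_{12}$, likewise $B_1,B_2,B_{12}$ for $B$, and $A_2,A_{12},B_2,B_{12}$ (the *aspects*) are all related by $\approx[\Psi_2]$. - $M\doteq N\in A\ [\Psi]$: $A\doteq A$ pretype, and the same for $M,N$ in place of $A,B$, the aspects being all related by $\approx_{A_{12}}[\Psi_2]$, where $A\psi_1\psi_2\Downarrow A_{12}$. We write $M\in A$ for $M\doteq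 M\in A$. - $\mathcal J\ [\Psi\mid\Xi]$ for a set $\Xi$ of dimension equations: $\mathcal J\psi\ [\Psi']$ holds for all $\psi:\Psi'\to\Psi$ that satisfy $\Xi$. - A pretype $A\ [\Psi]$ is *cubical* if for all $\psi:\Psi'\to\Psi$, $A\psi\Downarrow A_0$ and $M\approx_{A_0}N\ [\Psi']$ imply $M\doteq N\in A\psi\ [\Psi']$. - For $A\doteq B$ pretype $[\Psi]$, consider, for $\psi:\Psi'\to\Psi$, the hypotheses (i) $M\doteq O\in A\psi\ [\Psi']$; (ii) $N_i^\varepsilon\doteq N_j^{\varepsilon'}\in A\psi\ [\Psi',y\mid r_i=\varepsilon,r_j=\varepsilon']$ for all $i,j,\varepsilon,\varepsilon'$; (iii) $N_i^\varepsilon\doteq P_i^\varepsilon\in A\psi\ [\Psi',y\mid r_i=\varepsilon]$ for all $i,\varepsilon$; (iv) $N_i^\varepsilon\langle r/y\rangle\doteq M\in A\psi\ [\Psi'\mid r_i=\varepsilon]$ for all $i,\varepsilon$. Then $A,B$ are *equally Kan* if always: (1) under (i)–(iv), $\mathsf{hcom}_{A\psi}^{\vec r_i}(r\rightsquigarrow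 r',M;\overrightarrow{y.N_i^\varepsilon})\doteq\mathsf{hcom}_{B\psi}^{\vec r_i}(r\rightsquigarrow r',O;\overrightarrow{y.P_i^\varepsilon})\in A\psi\ [\Psi']$; (2) under $M\in A\psi$, (ii), (iv), $\mathsf{hcom}_{A\psi}^{\vec r_i}(r\rightsquigarrow r,M;\overrightarrow{y.N_i^\varepsilon})\doteq M\in A\psi\ [\Psi']$; (3) under the same hypotheses, if $r_i=\varepsilon$ then $\mathsf{hcom}_{A\psi}^{\vec r_i}(r\rightsquigarrow r',M;\overrightarrow{y.N_i^\varepsilon})\doteq N_i^\varepsilon\langle r'/y\rangle\in A\psi\ [\Psi']$; (4) for $\psi:(\Psi',x)\to\Psi$, if $M\doteq N\in A\psi\langle r/x\rangle\ [\Psi']$ then $\mathsf{coe}_{x.A\psi}^{r\rightsquigarrow r'}(M)\doteq\mathsf{coe}_{x.B\psi}^{r\rightsquigarrow r'}(N)\in A\psi\langle r'/x\rangle\ [\Psi']$; (5) for such $\psi$, if $M\in A\psi\langle r/x\rangle\ [\Psi']$ then $\mathsf{coe}_{x.A\psi}^{r\rightsquigarrow r}(M)\doteq M\in A\psi\langle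 r/x\rangle\ [\Psi']$. $A$ is *Kan* if $A,A$ are equally Kan. - $A\doteq B\ \mathsf{type}\ [\Psi]$: $A\doteq B$ pretype, both cubical, and equally Kan. - $a:C\gg A\doteq A'\ \mathsf{type}\ [\Psi]$, for a pretype $C$: for all $\psi:\Psi'\to\Psi$ and $N\doteq N'\in C\psi\ [\Psi']$, $A\psi[N/a]\doteq A'\psi[N'/a]$ type $[\Psi']$. The system *has booleans* if $\mathsf{bool}\approx\mathsf{bool}\ [\Psi]$ for all $\Psi$, and $\approx_{\mathsf{bool}}$ is the least family of relations such that $\mathsf{true}\approx_{\mathsf{bool}}\mathsf{true}$, $\mathsf{false}\approx_{\mathsf{bool}}\mathsf{false}$, and $\mathsf{hcom}_{\mathsf{bool}}^{\vec x_i}(r\rightsquigarrow r',M;\overrightarrow{y.N_i^\varepsilon})\approx_{\mathsf{bool}}\mathsf{hcom}_{\mathsf{bool}}^{\vec x_i}(r\rightsquigarrow r',O;\overrightarrow{y.P_i^\varepsilon})\ [\Psi]$ whenever the $x_i$ are names, $r\ne r'$, and (i)–(iv) hold with $r_i=x_i$ and $\mathsf{bool}$ for $A\psi$ (these equations being read relative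 to the family being defined). **Theorem.** In every cubical type system that has booleans, for all $\Psi$: 1. (Pretype, Kan, Cubical) $\mathsf{bool}$ is a pretype $[\Psi]$, is Kan and is cubical. 2. (Introduction) $\mathsf{true}\in\mathsf{bool}\ [\Psi]$ and $\mathsf{false}\in\mathsf{bool}\ [\Psi]$. 3. (Elimination) If $M\doteq M'\in\mathsf{bool}\ [\Psi]$, then $(\ast)_{M,M'}$: whenever $a:\mathsf{bool}\gg A\doteq A'$ type $[\Psi]$, $T\doteq T'\in A[\mathsf{true}/a]\ [\Psi]$ and $F\doteq F'\in A[\mathsf{false}/a]\ [\Psi]$, one has $\mathsf{if}_{a.A}(M;T,F)\doteq\mathsf{if}_{a.A'}(M';T',F')\in A[M/a]\ [\Psi]$. 4. If $M\doteq M'\in\mathsf{bool}\ [\Psi]$ and, for all $\psi_1,\psi_2$, the elimination rule holds for every pair of the aspects $M_2,M_{12},M_2',M_{12}'$ of $M,M'$, then $(\ast)_{M,M'}$ holds. 5. If $V\approx_{\mathsf{bool}}V'\ [\Psi]$ (in particular for two related $\mathsf{hcom}$ values), then $(\ast)_{V,V'}$ holds. 6. (Computation) If $a:\mathsf{bool}\gg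 A$ type $[\Psi]$, $T\in A[\mathsf{true}/a]\ [\Psi]$ and $F\in A[\mathsf{false}/a]\ [\Psi]$, then $\mathsf{if}_{a.A}(\mathsf{true};T,F)\doteq T\in A[\mathsf{true}/a]\ [\Psi]$ and $\mathsf{if}_{a.A}(\mathsf{false};T,F)\doteq F\in A[\mathsf{false}/a]\ [\Psi]$. -/

import Mathlib

/-! Syntax, operational semantics and meaning explanation of a cubical programming language.
Dimension contexts are finite sets of dimension names (natural numbers).  Terms are well scoped and
considered up to renaming of bound variables: `Tm D k` is the type of terms whose free dimension
names lie in `D` and whose free term variables are among `k` de Bruijn variables.  A term under a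
dimension binder lives in `Tm (Option D) k`, the bound name being `none`; a term under a term binder
lives in `Tm D (k + 1)`, the bound variable being `0`. -/

namespace CubTT

/-! ### Dimensions -/

/-- Dimension terms over the names `D`: the constants `0` (`const false`) and `1` (`const true`),
and the names. -/
inductive Dim (D : Type) : Type where
  | const (ε : Bool)
  | name (x : D)

/-- `r` is a dimension name (not a constant). -/
def Dim.IsName {D : Type} (r : Dim D) : Prop := ∃ x, r = .name x

/-- Total dimension substitutions `ψ : Y → X`, assigning to each name of `X` a dimension term
over `Y`. -/
abbrev DSub (X Y : Type) : Type := X → Dim Y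

/-- Action of a dimension substitution on a dimension term. -/
def Dim.sub {X Y : Type} (r : Dim X) (ψ : DSub X Y) : Dim Y :=
  match r with
  | .const ε => .const ε
  | .name x => ψ x

/-- The composite `ψ₁ψ₂`: first `ψ₁`, then `ψ₂`. -/
def DSub.comp {X Y Z : Type} (ψ₁ : DSub X Y) (ψ₂ : DSub Y Z) : DSub X Z := fun x => (ψ₁ x).sub ψ₂

/-- Weakening from `X` to `X, y`. -/
def DSub.wk {X : Type} : DSub X (Option X) := fun x => .name (some x)

/-- Weakening of a dimension term. -/
def Dim.wk {X : Type} (r : Dim X) : Dim (Option X) := r.sub DSub.wk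

/-- Passing under a dimension binder. -/
def DSub.lift {X Y : Type} (ψ : DSub X Y) : DSub (Option X) (Option Y)
  | none => .name none
  | some x => (ψ x).wk

/-- The substitution `⟨r/y⟩` for the last name `y`. -/
def DSub.inst {X : Type} (r : Dim X) : DSub (Option X) X
  | none => r
  | some x => .name x

/-- Exchange of the two last names. -/
def DSub.swap {X : Type} : DSub (Option (Option X)) (Option (Option X))
  | none => .name (some none)
  | some none => .name none
  | some (some x) => .name (some (some x))

/-! ### Terms -/

/-- Terms. The type and composition formers bind as follows: `pi A B` and `sigma A B` bind a term
variable in `B`; `Id A M N` and `dlam M` bind a dimension in `A`, resp. `M`; `ifb A M T F` and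
`S1elim A M P L` bind a term variable in `A`, and `S1elim` a dimension in `L`; `coe A r r' M` is
coercion along the line `x.A` from `r` to `r'`; `hcom rs A r r' M N` is homogeneous composition in
`A` from `r` to `r'`, with the nonempty list of extents `rs`, cap `M` and tube faces
`y.N i ε`, `ε = 0, 1`. -/
inductive Tm : Type → ℕ → Type 1 where
  | var {D : Type} {k : ℕ} (a : Fin k) : Tm D k
  | pi {D : Type} {k : ℕ} (A : Tm D k) (B : Tm D (k + 1)) : Tm D k
  | sigma {D : Type} {k : ℕ} (A : Tm D k) (B : Tm D (k + 1)) : Tm D k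
  | Id {D : Type} {k : ℕ} (A : Tm (Option D) k) (M N : Tm D k) : Tm D k
  | bool {D : Type} {k : ℕ} : Tm D k
  | notb {D : Type} {k : ℕ} (r : Dim D) : Tm D k
  | S1 {D : Type} {k : ℕ} : Tm D k
  | lam {D : Type} {k : ℕ} (M : Tm D (k + 1)) : Tm D k
  | app {D : Type} {k : ℕ} (M N : Tm D k) : Tm D k
  | pair {D : Type} {k : ℕ} (M N : Tm D k) : Tm D k
  | fst {D : Type} {k : ℕ} (M : Tm D k) : Tm D k
  | snd {D : Type} {k : ℕ} (M : Tm D k) : Tm D k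
  | dlam {D : Type} {k : ℕ} (M : Tm (Option D) k) : Tm D k
  | dapp {D : Type} {k : ℕ} (M : Tm D k) (r : Dim D) : Tm D k
  | tt {D : Type} {k : ℕ} : Tm D k
  | ff {D : Type} {k : ℕ} : Tm D k
  | ifb {D : Type} {k : ℕ} (A : Tm D (k + 1)) (M T F : Tm D k) : Tm D k
  | notel {D : Type} {k : ℕ} (r : Dim D) (M : Tm D k) : Tm D k
  | base {D : Type} {k : ℕ} : Tm D k
  | loop {D : Type} {k : ℕ} (r : Dim D) : Tm D k
  | S1elim {D : Type} {k : ℕ} (A : Tm D (k + 1)) (M P : Tm D k) (L : Tm (Option D) k) : Tm D k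
  | coe {D : Type} {k : ℕ} (A : Tm (Option D) k) (r r' : Dim D) (M : Tm D k) : Tm D k
  | hcom {D : Type} {k n : ℕ} (rs : Fin (n + 1) → Dim D) (A : Tm D k) (r r' : Dim D) (M : Tm D k)
      (N : Fin (n + 1) → Bool → Tm (Option D) k) : Tm D k

namespace Tm

/-- Simultaneous dimension substitution `Mψ`. -/
def dsub : {X Y : Type} → {k : ℕ} → Tm X k → DSub X Y → Tm Y k
  | _, _, _, .var a, _ => .var a
  | _, _, _, .pi A B, ψ => .pi (A.dsub ψ) (B.dsub ψ)
  | _, _, _, .sigma A B, ψ => .sigma (A.dsub ψ) (B.dsub ψ)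
  | _, _, _, .Id A M N, ψ => .Id (A.dsub ψ.lift) (M.dsub ψ) (N.dsub ψ)
  | _, _, _, .bool, _ => .bool
  | _, _, _, .notb r, ψ => .notb (r.sub ψ)
  | _, _, _, .S1, _ => .S1
  | _, _, _, .lam M, ψ => .lam (M.dsub ψ)
  | _, _, _, .app M N, ψ => .app (M.dsub ψ) (N.dsub ψ)
  | _, _, _, .pair M N, ψ => .pair (M.dsub ψ) (N.dsub ψ)
  | _, _, _, .fst M, ψ => .fst (M.dsub ψ)
  | _, _, _, .snd M, ψ => .snd (M.dsub ψ)
  | _, _, _, .dlam M, ψ => .dlam (M.dsub ψ.lift)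
  | _, _, _, .dapp M r, ψ => .dapp (M.dsub ψ) (r.sub ψ)
  | _, _, _, .tt, _ => .tt
  | _, _, _, .ff, _ => .ff
  | _, _, _, .ifb A M T F, ψ => .ifb (A.dsub ψ) (M.dsub ψ) (T.dsub ψ) (F.dsub ψ)
  | _, _, _, .notel r M, ψ => .notel (r.sub ψ) (M.dsub ψ)
  | _, _, _, .base, _ => .base
  | _, _, _, .loop r, ψ => .loop (r.sub ψ)
  | _, _, _, .S1elim A M P L, ψ => .S1elim (A.dsub ψ) (M.dsub ψ) (P.dsub ψ) (L.dsub ψ.lift)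
  | _, _, _, .coe A r r' M, ψ => .coe (A.dsub ψ.lift) (r.sub ψ) (r'.sub ψ) (M.dsub ψ)
  | _, _, _, .hcom rs A r r' M N, ψ =>
      .hcom (fun i => (rs i).sub ψ) (A.dsub ψ) (r.sub ψ) (r'.sub ψ) (M.dsub ψ)
        (fun i ε => (N i ε).dsub ψ.lift)

/-- Passing a renaming of term variables under a term binder. -/
def liftRen {k l : ℕ} (ρ : Fin k → Fin l) : Fin (k + 1) → Fin (l + 1) :=
  Fin.cases 0 (fun i => (ρ i).succ)

/-- Renaming of term variables. -/
def tren : {D : Type} → {k l : ℕ} → Tm D k → (Fin k → Fin l) → Tm D l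
  | _, _, _, .var a, ρ => .var (ρ a)
  | _, _, _, .pi A B, ρ => .pi (A.tren ρ) (B.tren (liftRen ρ))
  | _, _, _, .sigma A B, ρ => .sigma (A.tren ρ) (B.tren (liftRen ρ))
  | _, _, _, .Id A M N, ρ => .Id (A.tren ρ) (M.tren ρ) (N.tren ρ)
  | _, _, _, .bool, _ => .bool
  | _, _, _, .notb r, _ => .notb r
  | _, _, _, .S1, _ => .S1
  | _, _, _, .lam M, ρ => .lam (M.tren (liftRen ρ))
  | _, _, _, .app M N, ρ => .app (M.tren ρ) (N.tren ρ)
  | _, _, _, .pair M N, ρ => .pair (M.tren ρ) (N.tren ρ)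
  | _, _, _, .fst M, ρ => .fst (M.tren ρ)
  | _, _, _, .snd M, ρ => .snd (M.tren ρ)
  | _, _, _, .dlam M, ρ => .dlam (M.tren ρ)
  | _, _, _, .dapp M r, ρ => .dapp (M.tren ρ) r
  | _, _, _, .tt, _ => .tt
  | _, _, _, .ff, _ => .ff
  | _, _, _, .ifb A M T F, ρ => .ifb (A.tren (liftRen ρ)) (M.tren ρ) (T.tren ρ) (F.tren ρ)
  | _, _, _, .notel r M, ρ => .notel r (M.tren ρ)
  | _, _, _, .base, _ => .base
  | _, _, _, .loop r, _ => .loop r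
  | _, _, _, .S1elim A M P L, ρ =>
      .S1elim (A.tren (liftRen ρ)) (M.tren ρ) (P.tren ρ) (L.tren ρ)
  | _, _, _, .coe A r r' M, ρ => .coe (A.tren ρ) r r' (M.tren ρ)
  | _, _, _, .hcom rs A r r' M N, ρ =>
      .hcom rs (A.tren ρ) r r' (M.tren ρ) (fun i ε => (N i ε).tren ρ)

/-- Weakening by one dimension name. -/
def dwk {D : Type} {k : ℕ} (M : Tm D k) : Tm (Option D) k := M.dsub DSub.wk

/-- Weakening by one term variable. -/
def twk {D : Type} {k : ℕ} (M : Tm D k) : Tm D (k + 1) := M.tren Fin.succ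

/-- Passing a substitution of terms under a term binder. -/
def liftSub {D : Type} {k l : ℕ} (σ : Fin k → Tm D l) : Fin (k + 1) → Tm D (l + 1) :=
  Fin.cases (.var 0) (fun i => (σ i).twk)

/-- Simultaneous capture-avoiding substitution of terms for term variables. -/
def tsub : {D : Type} → {k l : ℕ} → Tm D k → (Fin k → Tm D l) → Tm D l
  | _, _, _, .var a, σ => σ a
  | _, _, _, .pi A B, σ => .pi (A.tsub σ) (B.tsub (liftSub σ))
  | _, _, _, .sigma A B, σ => .sigma (A.tsub σ) (B.tsub (liftSub σ))
  | _, _, _, .Id A M N, σ => .Id (A.tsub (fun i => (σ i).dwk)) (M.tsub σ) (N.tsub σ)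
  | _, _, _, .bool, _ => .bool
  | _, _, _, .notb r, _ => .notb r
  | _, _, _, .S1, _ => .S1
  | _, _, _, .lam M, σ => .lam (M.tsub (liftSub σ))
  | _, _, _, .app M N, σ => .app (M.tsub σ) (N.tsub σ)
  | _, _, _, .pair M N, σ => .pair (M.tsub σ) (N.tsub σ)
  | _, _, _, .fst M, σ => .fst (M.tsub σ)
  | _, _, _, .snd M, σ => .snd (M.tsub σ)
  | _, _, _, .dlam M, σ => .dlam (M.tsub (fun i => (σ i).dwk))
  | _, _, _, .dapp M r, σ => .dapp (M.tsub σ) r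
  | _, _, _, .tt, _ => .tt
  | _, _, _, .ff, _ => .ff
  | _, _, _, .ifb A M T F, σ => .ifb (A.tsub (liftSub σ)) (M.tsub σ) (T.tsub σ) (F.tsub σ)
  | _, _, _, .notel r M, σ => .notel r (M.tsub σ)
  | _, _, _, .base, _ => .base
  | _, _, _, .loop r, _ => .loop r
  | _, _, _, .S1elim A M P L, σ =>
      .S1elim (A.tsub (liftSub σ)) (M.tsub σ) (P.tsub σ) (L.tsub (fun i => (σ i).dwk))
  | _, _, _, .coe A r r' M, σ => .coe (A.tsub (fun i => (σ i).dwk)) r r' (M.tsub σ)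
  | _, _, _, .hcom rs A r r' M N, σ =>
      .hcom rs (A.tsub σ) r r' (M.tsub σ) (fun i ε => (N i ε).tsub (fun j => (σ j).dwk))

/-- `M⟨r/y⟩`, for the last dimension name `y`. -/
def dinst {D : Type} {k : ℕ} (M : Tm (Option D) k) (r : Dim D) : Tm D k := M.dsub (DSub.inst r)

/-- `M[N/a]`, for the only term variable `a` of `M`. -/
def inst {D : Type} {l : ℕ} (M : Tm D 1) (N : Tm D l) : Tm D l := M.tsub (fun _ => N)

/-- Weakening of `M` by a dimension name `x`, where `M` lives under one dimension binder `y`. -/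
def dwkUnder {D : Type} {k : ℕ} (M : Tm (Option D) k) : Tm (Option (Option D)) k :=
  M.dsub DSub.wk.lift

/-- Boolean negation, `if_{_.bool}(M; false, true)`. -/
def notf {D : Type} {k : ℕ} (M : Tm D k) : Tm D k := .ifb .bool M .ff .tt

/-- Heterogeneous composition
`com^{rs}_{y.A}(r ⇝ r', M; y.N) = hcom^{rs}_{A⟨r'/y⟩}(r ⇝ r', coe_{y.A}^{r⇝r'}(M);
y.coe_{y.A}^{y⇝r'}(N))`. -/
def com {D : Type} {k n : ℕ} (rs : Fin (n + 1) → Dim D) (A : Tm (Option D) k) (r r' : Dim D)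
    (M : Tm D k) (N : Fin (n + 1) → Bool → Tm (Option D) k) : Tm D k :=
  .hcom rs (A.dinst r') r r' (.coe A r r' M)
    (fun i ε => .coe A.dwkUnder (.name none) r'.wk (N i ε))

end Tm

/-! ### Operational semantics -/

/-- Values (canonical forms) among the terms without free term variables. -/
inductive IsVal : {D : Type} → Tm D 0 → Prop where
  | pi {D : Type} (A : Tm D 0) (B : Tm D 1) : IsVal (.pi A B)
  | sigma {D : Type} (A : Tm D 0) (B : Tm D 1) : IsVal (.sigma A B)
  | Id {D : Type} (A : Tm (Option D) 0) (M N : Tm D 0) : IsVal (.Id A M N)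
  | bool {D : Type} : IsVal (.bool : Tm D 0)
  | notb {D : Type} (x : D) : IsVal (.notb (.name x))
  | S1 {D : Type} : IsVal (.S1 : Tm D 0)
  | lam {D : Type} (M : Tm D 1) : IsVal (.lam M)
  | pair {D : Type} (M N : Tm D 0) : IsVal (.pair M N)
  | dlam {D : Type} (M : Tm (Option D) 0) : IsVal (.dlam M)
  | tt {D : Type} : IsVal (.tt : Tm D 0)
  | ff {D : Type} : IsVal (.ff : Tm D 0)
  | hcom_bool {D : Type} {n : ℕ} (rs : Fin (n + 1) → Dim D) (r r' : Dim D) (M : Tm D 0)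
      (N : Fin (n + 1) → Bool → Tm (Option D) 0) :
      (∀ i, (rs i).IsName) → r ≠ r' → IsVal (.hcom rs .bool r r' M N)
  | base {D : Type} : IsVal (.base : Tm D 0)
  | loop {D : Type} (x : D) : IsVal (.loop (.name x))
  | hcom_S1 {D : Type} {n : ℕ} (rs : Fin (n + 1) → Dim D) (r r' : Dim D) (M : Tm D 0)
      (N : Fin (n + 1) → Bool → Tm (Option D) 0) :
      (∀ i, (rs i).IsName) → r ≠ r' → IsVal (.hcom rs .S1 r r' M N)
  | notel {D : Type} (x : D) (M : Tm D 0) : IsVal (.notel (.name x) M)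

open Tm in
/-- One step of evaluation. -/
inductive Step : {D : Type} → Tm D 0 → Tm D 0 → Prop where
  -- types
  | notb_const {D : Type} (ε : Bool) : Step (.notb (.const ε) : Tm D 0) .bool
  -- principal arguments of coe and hcom
  | coe_type {D : Type} {A A' : Tm (Option D) 0} (r r' : Dim D) (M : Tm D 0) :
      Step A A' → Step (.coe A r r' M) (.coe A' r r' M)
  | hcom_type {D : Type} {n : ℕ} (rs : Fin (n + 1) → Dim D) {A A' : Tm D 0} (r r' : Dim D)
      (M : Tm D 0) (N : Fin (n + 1) → Bool → Tm (Option D) 0) :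
      Step A A' → Step (.hcom rs A r r' M N) (.hcom rs A' r r' M N)
  -- dependent function types
  | app_fun {D : Type} {M M' : Tm D 0} (N : Tm D 0) : Step M M' → Step (.app M N) (.app M' N)
  | app_lam {D : Type} (M : Tm D 1) (N : Tm D 0) : Step (.app (.lam M) N) (M.inst N)
  | hcom_pi {D : Type} {n : ℕ} (rs : Fin (n + 1) → Dim D) (A : Tm D 0) (B : Tm D 1) (r r' : Dim D)
      (M : Tm D 0) (N : Fin (n + 1) → Bool → Tm (Option D) 0) :
      Step (.hcom rs (.pi A B) r r' M N)
        (.lam (.hcom rs B r r' (.app M.twk (.var 0)) (fun i ε => .app (N i ε).twk (.var 0))))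
  | coe_pi {D : Type} (A : Tm (Option D) 0) (B : Tm (Option D) 1) (r r' : Dim D) (M : Tm D 0) :
      Step (.coe (.pi A B) r r' M)
        (.lam (.coe (B.inst (.coe A.dwkUnder.twk r'.wk (.name none) (.var 0))) r r'
          (.app M.twk (.coe A.twk r' r (.var 0)))))
  -- dependent pair types
  | fst_arg {D : Type} {M M' : Tm D 0} : Step M M' → Step (.fst M) (.fst M')
  | snd_arg {D : Type} {M M' : Tm D 0} : Step M M' → Step (.snd M) (.snd M')
  | fst_pair {D : Type} (M N : Tm D 0) : Step (.fst (.pair M N)) M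
  | snd_pair {D : Type} (M N : Tm D 0) : Step (.snd (.pair M N)) N
  | hcom_sigma {D : Type} {n : ℕ} (rs : Fin (n + 1) → Dim D) (A : Tm D 0) (B : Tm D 1)
      (r r' : Dim D) (M : Tm D 0) (N : Fin (n + 1) → Bool → Tm (Option D) 0) :
      Step (.hcom rs (.sigma A B) r r' M N)
        (.pair (.hcom rs A r r' (.fst M) (fun i ε => .fst (N i ε)))
          (com rs
            (B.dwk.inst (.hcom (fun i => (rs i).wk) A.dwk r.wk (.name none) (.fst M.dwk)
              (fun i ε => .fst (N i ε).dwkUnder)))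
            r r' (.snd M) (fun i ε => .snd (N i ε))))
  | coe_sigma {D : Type} (A : Tm (Option D) 0) (B : Tm (Option D) 1) (r r' : Dim D) (M : Tm D 0) :
      Step (.coe (.sigma A B) r r' M)
        (.pair (.coe A r r' (.fst M))
          (.coe (B.inst (.coe A.dwkUnder r.wk (.name none) (.fst M.dwk))) r r' (.snd M)))
  -- identification types
  | dapp_arg {D : Type} {M M' : Tm D 0} (r : Dim D) : Step M M' → Step (.dapp M r) (.dapp M' r)
  | dapp_dlam {D : Type} (M : Tm (Option D) 0) (r : Dim D) : Step (.dapp (.dlam M) r) (M.dinst r)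
  | hcom_Id {D : Type} {n : ℕ} (rs : Fin (n + 1) → Dim D) (A : Tm (Option D) 0) (P₀ P₁ : Tm D 0)
      (r r' : Dim D) (M : Tm D 0) (N : Fin (n + 1) → Bool → Tm (Option D) 0) :
      Step (.hcom rs (.Id A P₀ P₁) r r' M N)
        (.dlam (.hcom (Fin.snoc (α := fun _ => Dim (Option D)) (fun i => (rs i).wk) (.name none))
          A r.wk r'.wk (.dapp M.dwk (.name none))
          (Fin.snoc (α := fun _ => Bool → Tm (Option (Option D)) 0)
            (fun i ε => .dapp (N i ε).dwkUnder (.name (some none)))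
            (fun ε => (bif ε then P₁ else P₀).dwk.dwk))))
  | coe_Id {D : Type} (A : Tm (Option (Option D)) 0) (P₀ P₁ : Tm (Option D) 0) (r r' : Dim D)
      (M : Tm D 0) :
      Step (.coe (.Id A P₀ P₁) r r' M)
        (.dlam (com (n := 0) (fun _ => .name none) (A.dsub DSub.swap) r.wk r'.wk
          (.dapp M.dwk (.name none)) (fun _ ε => (bif ε then P₁ else P₀).dwkUnder)))
  -- booleans
  | hcom_bool_tube {D : Type} {n : ℕ} (rs : Fin (n + 1) → Dim D) (r r' : Dim D) (M : Tm D 0)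
      (N : Fin (n + 1) → Bool → Tm (Option D) 0) (i : Fin (n + 1)) (ε : Bool) :
      (∀ j < i, (rs j).IsName) → rs i = .const ε →
      Step (.hcom rs .bool r r' M N) ((N i ε).dinst r')
  | hcom_bool_cap {D : Type} {n : ℕ} (rs : Fin (n + 1) → Dim D) (r r' : Dim D) (M : Tm D 0)
      (N : Fin (n + 1) → Bool → Tm (Option D) 0) :
      (∀ i, (rs i).IsName) → r = r' → Step (.hcom rs .bool r r' M N) M
  | if_arg {D : Type} (A : Tm D 1) {M M' : Tm D 0} (T F : Tm D 0) :
      Step M M' → Step (.ifb A M T F) (.ifb A M' T F)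
  | if_tt {D : Type} (A : Tm D 1) (T F : Tm D 0) : Step (.ifb A .tt T F) T
  | if_ff {D : Type} (A : Tm D 1) (T F : Tm D 0) : Step (.ifb A .ff T F) F
  | if_hcom {D : Type} {n : ℕ} (A : Tm D 1) (rs : Fin (n + 1) → Dim D) (r r' : Dim D) (M : Tm D 0)
      (N : Fin (n + 1) → Bool → Tm (Option D) 0) (T F : Tm D 0) :
      (∀ i, (rs i).IsName) → r ≠ r' →
      Step (.ifb A (.hcom rs .bool r r' M N) T F)
        (com rs
          (A.dwk.inst (.hcom (fun i => (rs i).wk) .bool r.wk (.name none) M.dwk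
            (fun i ε => (N i ε).dwkUnder)))
          r r' (.ifb A M T F) (fun i ε => .ifb A.dwk (N i ε) T.dwk F.dwk))
  | coe_bool {D : Type} (r r' : Dim D) (M : Tm D 0) : Step (.coe .bool r r' M) M
  -- circle
  | hcom_S1_tube {D : Type} {n : ℕ} (rs : Fin (n + 1) → Dim D) (r r' : Dim D) (M : Tm D 0)
      (N : Fin (n + 1) → Bool → Tm (Option D) 0) (i : Fin (n + 1)) (ε : Bool) :
      (∀ j < i, (rs j).IsName) → rs i = .const ε →
      Step (.hcom rs .S1 r r' M N) ((N i ε).dinst r')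
  | hcom_S1_cap {D : Type} {n : ℕ} (rs : Fin (n + 1) → Dim D) (r r' : Dim D) (M : Tm D 0)
      (N : Fin (n + 1) → Bool → Tm (Option D) 0) :
      (∀ i, (rs i).IsName) → r = r' → Step (.hcom rs .S1 r r' M N) M
  | loop_const {D : Type} (ε : Bool) : Step (.loop (.const ε) : Tm D 0) .base
  | S1elim_arg {D : Type} (A : Tm D 1) {M M' : Tm D 0} (P : Tm D 0) (L : Tm (Option D) 0) :
      Step M M' → Step (.S1elim A M P L) (.S1elim A M' P L)
  | S1elim_base {D : Type} (A : Tm D 1) (P : Tm D 0) (L : Tm (Option D) 0) :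
      Step (.S1elim A .base P L) P
  | S1elim_loop {D : Type} (A : Tm D 1) (x : D) (P : Tm D 0) (L : Tm (Option D) 0) :
      Step (.S1elim A (.loop (.name x)) P L) (L.dinst (.name x))
  | S1elim_hcom {D : Type} {n : ℕ} (A : Tm D 1) (rs : Fin (n + 1) → Dim D) (r r' : Dim D)
      (M : Tm D 0) (N : Fin (n + 1) → Bool → Tm (Option D) 0) (P : Tm D 0) (L : Tm (Option D) 0) :
      (∀ i, (rs i).IsName) → r ≠ r' →
      Step (.S1elim A (.hcom rs .S1 r r' M N) P L)
        (com rs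
          (A.dwk.inst (.hcom (fun i => (rs i).wk) .S1 r.wk (.name none) M.dwk
            (fun i ε => (N i ε).dwkUnder)))
          r r' (.S1elim A M P L) (fun i ε => .S1elim A.dwk (N i ε) P.dwk L.dwkUnder))
  | coe_S1 {D : Type} (r r' : Dim D) (M : Tm D 0) : Step (.coe .S1 r r' M) M
  -- not
  | notel_zero {D : Type} (M : Tm D 0) : Step (.notel (.const false) M) M.notf
  | notel_one {D : Type} (M : Tm D 0) : Step (.notel (.const true) M) M
  | coe_notb_flip {D : Type} (ε : Bool) (M : Tm D 0) :
      Step (.coe (.notb (.name none)) (.const ε) (.const (!ε)) M) M.notf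
  | coe_notb_same {D : Type} (ε : Bool) (M : Tm D 0) :
      Step (.coe (.notb (.name none)) (.const ε) (.const ε) M) M
  | coe_notb_zero_name {D : Type} (x : D) (M : Tm D 0) :
      Step (.coe (.notb (.name none)) (.const false) (.name x) M) (.notel (.name x) M.notf)
  | coe_notb_one_name {D : Type} (x : D) (M : Tm D 0) :
      Step (.coe (.notb (.name none)) (.const true) (.name x) M) (.notel (.name x) M)
  | coe_notb_arg {D : Type} (x : D) (r : Dim D) {M M' : Tm D 0} :
      Step M M' →
      Step (.coe (.notb (.name none)) (.name x) r M) (.coe (.notb (.name none)) (.name x) r M')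
  | coe_notb_notel {D : Type} (x : D) (r : Dim D) (M : Tm D 0) :
      Step (.coe (.notb (.name none)) (.name x) r (.notel (.name x) M)) (.notel r M)
  | coe_notb_other {D : Type} (y : D) (r r' : Dim D) (M : Tm D 0) :
      Step (.coe (.notb (.name (some y))) r r' M) M
  | hcom_notb {D : Type} {n : ℕ} (rs : Fin (n + 1) → Dim D) (w : D) (r r' : Dim D) (M : Tm D 0)
      (N : Fin (n + 1) → Bool → Tm (Option D) 0) :
      Step (.hcom rs (.notb (.name w)) r r' M N)
        (.notel (.name w) (.hcom rs .bool r r'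
          (.coe (.notb (.name none)) (.name w) (.const true) M)
          (fun i ε => .coe (.notb (.name none)) (.name (some w)) (.const true) (N i ε))))

/-- `M ⇓ V`: `M` evaluates to the value `V`. -/
def Eval {D : Type} (M V : Tm D 0) : Prop := Relation.ReflTransGen Step M V ∧ IsVal V

/-! ### Cubical type systems -/

/-- Dimension contexts: finite sets of dimension names.  The extension of `Ψ` by a name `y` that
does not occur in it is represented by `Option Ψ`. -/
abbrev Ctx : Type := Finset ℕ

/-- Closed terms in the dimension context `Ψ`. -/
abbrev CTm (Ψ : Ctx) : Type 1 := Tm Ψ 0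

/-- A cubical type system: for each `Ψ` a partial equivalence relation `E Ψ` on values, and for each
`E Ψ A B` partial equivalence relations `Φ Ψ A` and `Φ Ψ B` on values, which agree. (What `Φ Ψ A` is
when `A` is not in the domain of `E Ψ` is immaterial.) -/
structure CTS where
  E : (Ψ : Ctx) → CTm Ψ → CTm Ψ → Prop
  Φ : (Ψ : Ctx) → CTm Ψ → CTm Ψ → CTm Ψ → Prop
  E_val : ∀ {Ψ : Ctx} {A B : CTm Ψ}, E Ψ A B → IsVal A ∧ IsVal B
  E_symm : ∀ {Ψ : Ctx} {A B : CTm Ψ}, E Ψ A B → E Ψ B A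
  E_trans : ∀ {Ψ : Ctx} {A B C : CTm Ψ}, E Ψ A B → E Ψ B C → E Ψ A C
  Φ_val : ∀ {Ψ : Ctx} {A M N : CTm Ψ}, E Ψ A A → Φ Ψ A M N → IsVal M ∧ IsVal N
  Φ_symm : ∀ {Ψ : Ctx} {A M N : CTm Ψ}, E Ψ A A → Φ Ψ A M N → Φ Ψ A N M
  Φ_trans : ∀ {Ψ : Ctx} {A M N O : CTm Ψ}, E Ψ A A → Φ Ψ A M N → Φ Ψ A N O → Φ Ψ A M O
  Φ_resp : ∀ {Ψ : Ctx} {A B M N : CTm Ψ}, E Ψ A B → (Φ Ψ A M N ↔ Φ Ψ B M N)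

/-- `R` relates all of `a, b, c, d` to each other. -/
def RelFour {α : Type*} (R : α → α → Prop) (a b c d : α) : Prop :=
  ∀ x ∈ [a, b, c, d], ∀ y ∈ [a, b, c, d], R x y

/-- Coherent aspects: for all `ψ₁ : Ψ₁ → Ψ` and `ψ₂ : Ψ₂ → Ψ₁`, one has `Mψ₁ ⇓ M₁`, `M₁ψ₂ ⇓ M₂`,
`Mψ₁ψ₂ ⇓ M₁₂`, likewise for `N`, and `M₂, M₁₂, N₂, N₁₂` are all related by `R` at `ψ₁ψ₂`. -/
def Coherent {Ψ : Ctx} (R : (Ψ₂ : Ctx) → DSub Ψ Ψ₂ → CTm Ψ₂ → CTm Ψ₂ → Prop) (M N : CTm Ψ) :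
    Prop :=
  ∀ (Ψ₁ : Ctx) (ψ₁ : DSub Ψ Ψ₁) (Ψ₂ : Ctx) (ψ₂ : DSub Ψ₁ Ψ₂),
    ∃ (M₁ : CTm Ψ₁) (M₂ M₁₂ : CTm Ψ₂) (N₁ : CTm Ψ₁) (N₂ N₁₂ : CTm Ψ₂),
      (Eval (M.dsub ψ₁) M₁ ∧ Eval (M₁.dsub ψ₂) M₂ ∧ Eval (M.dsub (ψ₁.comp ψ₂)) M₁₂) ∧
      (Eval (N.dsub ψ₁) N₁ ∧ Eval (N₁.dsub ψ₂) N₂ ∧ Eval (N.dsub (ψ₁.comp ψ₂)) N₁₂) ∧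
      RelFour (R Ψ₂ (ψ₁.comp ψ₂)) M₂ M₁₂ N₂ N₁₂

/-- A set `Ξ` of equations between dimension terms over `X` is satisfied by `ψ`. -/
def Satisfies {X Y : Type} (ψ : DSub X Y) (Ξ : List (Dim X × Dim X)) : Prop :=
  ∀ e ∈ Ξ, e.1.sub ψ = e.2.sub ψ

namespace CTS

variable (ts : CTS)

/-! #### Closed judgments -/

/-- `A ≐ B pretype [Ψ]`. -/
def EqPretype (Ψ : Ctx) (A B : CTm Ψ) : Prop := Coherent (fun Ψ₂ _ => ts.E Ψ₂) A B

/-- `M ≐ N ∈ A [Ψ]`, including its presupposition that `A` is a pretype. -/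
def EqTm (Ψ : Ctx) (M N A : CTm Ψ) : Prop :=
  ts.EqPretype Ψ A A ∧
  Coherent (fun Ψ₂ ψ V W => ∃ A₁₂ : CTm Ψ₂, Eval (A.dsub ψ) A₁₂ ∧ ts.Φ Ψ₂ A₁₂ V W) M N

/-- `M ≐ N ∈ A [X | Ξ]`: equality under the context restriction `Ξ`. Here `X` is `Ψ` or an extension
`Ψ, y`. -/
def EqTmRes {X : Type} (Ξ : List (Dim X × Dim X)) (M N A : Tm X 0) : Prop :=
  ∀ (Ψ' : Ctx) (ψ : DSub X Ψ'), Satisfies ψ Ξ → ts.EqTm Ψ' (M.dsub ψ) (N.dsub ψ) (A.dsub ψ)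

/-- The pretype `A` is cubical. -/
def Cubical (Ψ : Ctx) (A : CTm Ψ) : Prop :=
  ∀ (Ψ' : Ctx) (ψ : DSub Ψ Ψ') (A₀ M N : CTm Ψ'),
    Eval (A.dsub ψ) A₀ → ts.Φ Ψ' A₀ M N → ts.EqTm Ψ' M N (A.dsub ψ)

/-- The tube faces `y.N i ε` over the extents `rs` are pairwise equal in `A` where they overlap. -/
def TubesAdjacent {Ψ : Ctx} {n : ℕ} (rs : Fin (n + 1) → Dim Ψ)
    (N : Fin (n + 1) → Bool → Tm (Option Ψ) 0) (A : CTm Ψ) : Prop :=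
  ∀ (i j : Fin (n + 1)) (ε ε' : Bool),
    ts.EqTmRes [((rs i).wk, .const ε), ((rs j).wk, .const ε')] (N i ε) (N j ε') A.dwk

/-- The tube faces `y.N i ε` and `y.P i ε` over the extents `rs` are equal in `A`. -/
def TubesEq {Ψ : Ctx} {n : ℕ} (rs : Fin (n + 1) → Dim Ψ)
    (N P : Fin (n + 1) → Bool → Tm (Option Ψ) 0) (A : CTm Ψ) : Prop :=
  ∀ (i : Fin (n + 1)) (ε : Bool), ts.EqTmRes [((rs i).wk, .const ε)] (N i ε) (P i ε) A.dwk

/-- The starting sides (at `r`) of the tube faces `y.N i ε` match the cap `M`. -/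
def CapMatches {Ψ : Ctx} {n : ℕ} (rs : Fin (n + 1) → Dim Ψ) (r : Dim Ψ)
    (N : Fin (n + 1) → Bool → Tm (Option Ψ) 0) (M A : CTm Ψ) : Prop :=
  ∀ (i : Fin (n + 1)) (ε : Bool), ts.EqTmRes [(rs i, .const ε)] ((N i ε).dinst r) M A

/-- `A` and `B` are equally Kan (presupposing `A ≐ B pretype`). -/
def EquallyKan (Ψ : Ctx) (A B : CTm Ψ) : Prop :=
  (∀ (Ψ' : Ctx) (ψ : DSub Ψ Ψ') (n : ℕ) (rs : Fin (n + 1) → Dim Ψ') (r r' : Dim Ψ')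
      (M O : CTm Ψ') (N P : Fin (n + 1) → Bool → Tm (Option Ψ') 0),
      ts.EqTm Ψ' M O (A.dsub ψ) → ts.TubesAdjacent rs N (A.dsub ψ) →
      ts.TubesEq rs N P (A.dsub ψ) → ts.CapMatches rs r N M (A.dsub ψ) →
      ts.EqTm Ψ' (.hcom rs (A.dsub ψ) r r' M N) (.hcom rs (B.dsub ψ) r r' O P) (A.dsub ψ)) ∧
  (∀ (Ψ' : Ctx) (ψ : DSub Ψ Ψ') (n : ℕ) (rs : Fin (n + 1) → Dim Ψ') (r : Dim Ψ')
      (M : CTm Ψ') (N : Fin (n + 1) → Bool → Tm (Option Ψ') 0),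
      ts.EqTm Ψ' M M (A.dsub ψ) → ts.TubesAdjacent rs N (A.dsub ψ) →
      ts.CapMatches rs r N M (A.dsub ψ) →
      ts.EqTm Ψ' (.hcom rs (A.dsub ψ) r r M N) M (A.dsub ψ)) ∧
  (∀ (Ψ' : Ctx) (ψ : DSub Ψ Ψ') (n : ℕ) (rs : Fin (n + 1) → Dim Ψ') (r r' : Dim Ψ')
      (M : CTm Ψ') (N : Fin (n + 1) → Bool → Tm (Option Ψ') 0),
      ts.EqTm Ψ' M M (A.dsub ψ) → ts.TubesAdjacent rs N (A.dsub ψ) →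
      ts.CapMatches rs r N M (A.dsub ψ) →
      ∀ (i : Fin (n + 1)) (ε : Bool), rs i = .const ε →
        ts.EqTm Ψ' (.hcom rs (A.dsub ψ) r r' M N) ((N i ε).dinst r') (A.dsub ψ)) ∧
  (∀ (Ψ' : Ctx) (ψ : DSub Ψ (Option Ψ')) (r r' : Dim Ψ') (M N : CTm Ψ'),
      ts.EqTm Ψ' M N ((A.dsub ψ).dinst r) →
      ts.EqTm Ψ' (.coe (A.dsub ψ) r r' M) (.coe (B.dsub ψ) r r' N) ((A.dsub ψ).dinst r')) ∧
  (∀ (Ψ' : Ctx) (ψ : DSub Ψ (Option Ψ')) (r : Dim Ψ') (M : CTm Ψ'),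
      ts.EqTm Ψ' M M ((A.dsub ψ).dinst r) →
      ts.EqTm Ψ' (.coe (A.dsub ψ) r r M) M ((A.dsub ψ).dinst r))

/-- `A ≐ B type [Ψ]`: equal pretypes that are cubical and equally Kan. -/
def EqType (Ψ : Ctx) (A B : CTm Ψ) : Prop :=
  ts.EqPretype Ψ A B ∧ ts.Cubical Ψ A ∧ ts.Cubical Ψ B ∧ ts.EquallyKan Ψ A B

/-! #### Open judgments, in a context with one variable `a : C` -/

/-- `a : C ≫ B ≐ B' pretype [Ψ]`, including its presupposition that `C` is a pretype. -/
def EqPretypeOpen (Ψ : Ctx) (C : CTm Ψ) (B B' : Tm Ψ 1) : Prop :=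
  ts.EqPretype Ψ C C ∧
  ∀ (Ψ' : Ctx) (ψ : DSub Ψ Ψ') (N N' : CTm Ψ'), ts.EqTm Ψ' N N' (C.dsub ψ) →
    ts.EqPretype Ψ' ((B.dsub ψ).inst N) ((B'.dsub ψ).inst N')

/-- `a : C ≫ B ≐ B' type [Ψ]`, including its presuppositions. -/
def EqTypeOpen (Ψ : Ctx) (C : CTm Ψ) (B B' : Tm Ψ 1) : Prop :=
  ts.EqPretypeOpen Ψ C B B' ∧
  ∀ (Ψ' : Ctx) (ψ : DSub Ψ Ψ') (N N' : CTm Ψ'), ts.EqTm Ψ' N N' (C.dsub ψ) →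
    ts.EqType Ψ' ((B.dsub ψ).inst N) ((B'.dsub ψ).inst N')

end CTS

/-! ### Booleans -/

/-- The relation `R` on closed terms, read as a candidate for equality of values in `bool`, extended
to closed terms under a context restriction: `Mψ` and `Nψ` have coherent aspects related by `R`, for
all `ψ` satisfying `Ξ`. -/
def CohRes (R : (Ψ : Ctx) → CTm Ψ → CTm Ψ → Prop) {X : Type} (Ξ : List (Dim X × Dim X))
    (M N : Tm X 0) : Prop :=
  ∀ (Ψ' : Ctx) (ψ : DSub X Ψ'), Satisfies ψ Ξ →
    Coherent (fun Ψ₂ _ => R Ψ₂) (M.dsub ψ) (N.dsub ψ)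

/-- Closure of a family of relations under the three clauses defining equality of boolean values. In
the premises of the third clause, an equation in `bool` is read relative to `R`. -/
def BoolClosed (R : (Ψ : Ctx) → CTm Ψ → CTm Ψ → Prop) : Prop :=
  (∀ Ψ : Ctx, R Ψ .tt .tt) ∧
  (∀ Ψ : Ctx, R Ψ .ff .ff) ∧
  (∀ (Ψ : Ctx) (n : ℕ) (xs : Fin (n + 1) → Ψ) (r r' : Dim Ψ) (M O : CTm Ψ)
      (N P : Fin (n + 1) → Bool → Tm (Option Ψ) 0),
      r ≠ r' →
      Coherent (fun Ψ₂ _ => R Ψ₂) M O →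
      (∀ i j ε ε', CohRes R [((Dim.name (xs i)).wk, .const ε), ((Dim.name (xs j)).wk, .const ε')]
        (N i ε) (N j ε')) →
      (∀ i ε, CohRes R [((Dim.name (xs i)).wk, .const ε)] (N i ε) (P i ε)) →
      (∀ i ε, CohRes R [(.name (xs i), .const ε)] ((N i ε).dinst r) M) →
      R Ψ (.hcom (fun i => .name (xs i)) .bool r r' M N)
        (.hcom (fun i => .name (xs i)) .bool r r' O P))

/-- The cubical type system has booleans: `bool` is a type value in every context, and equality of
values in `bool` is the least family of relations closed under the three clauses. -/
def CTS.HasBool (ts : CTS) : Prop :=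
  (∀ Ψ : Ctx, ts.E Ψ .bool .bool) ∧
  BoolClosed (fun Ψ => ts.Φ Ψ .bool) ∧
  (∀ R : (Ψ : Ctx) → CTm Ψ → CTm Ψ → Prop, BoolClosed R →
    ∀ (Ψ : Ctx) (V W : CTm Ψ), ts.Φ Ψ .bool V W → R Ψ V W)

/-- The conclusion of the elimination rule at the scrutinees `M, M'`: for all equal families `A, A'`
of types over `bool` and all equal branches, the eliminators are equal in `A[M/a]`. -/
def CTS.IfRespects (ts : CTS) (Ψ : Ctx) (M M' : CTm Ψ) : Prop :=
  ∀ (A A' : Tm Ψ 1) (T T' F F' : CTm Ψ),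
    ts.EqTypeOpen Ψ .bool A A' →
    ts.EqTm Ψ T T' (A.inst .tt) →
    ts.EqTm Ψ F F' (A.inst .ff) →
    ts.EqTm Ψ (.ifb A M T F) (.ifb A' M' T' F') (A.inst M)

end CubTT

/-! Evaluation is deterministic but does not commute with dimension substitution, so equality asks
that evaluating before, between or after two substitutions give related values. For partial
equivalence relations this splits into two checks at every instance (`EqTm.of_eqVal`): the two terms
have related values (`EqVal`), and each term has a value whose further instances agree with those of
the term (`StableVal`). The consequence used throughout is coherent expansion, `EqTm.expand`: it
suffices that every instance of `M` evaluates to a term equal to the corresponding instance of `O`,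
even if different instances take different rules.

A composition in `bool` steps to the tube face at its first constant extent, or to its cap, or is a
value. A substitution can move it from one case to another, but adjacency of the faces and the cap
condition make the possible results equal; expansion then gives the cap and tube laws. Two equal
compositions are either both values, related by the third clause defining boolean equality, or both
reduce to equal terms. As the premises are stable under substitution, this holds at all instances,
which proves the Kan condition for composition. Coercion in `bool` steps to its argument. Cubicality
is a case analysis by leastness: `true` and `false` are fixed by substitution, and composition
values fall under the Kan condition.

Elimination is an induction on equality of boolean values, by leastness applied to `IfVal`: related
values on which the eliminator respects equality. The premises of the composition clause speak of
terms, so the property is lifted from values to terms by `HasBool.ifRespects_of_aspects`: `if`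
evaluates its scrutinee first, hence is governed by the aspects of the scrutinee. For a composition
`h`, the eliminator equals its contractum `ifCom` whether or not `h` is a value. Indeed the
instances of `if` at `h` step to `if` at a face, `if` at the cap, or the contractum, and the tube,
cap and composition laws of the type `A[h]` match these cases, with coercion over `s ⇝ s` being the
identity. Related contracta are equal because `A[h]` and `A'[h']` are equally Kan. The line of types
`A[h^z]` is legitimate since the Kan condition of `bool` is already available. -/

namespace CubTT

/-! ### Substitution -/

namespace Dim

theorem sub_sub {X Y Z : Type} (r : Dim X) (ψ : DSub X Y) (φ : DSub Y Z) :
    (r.sub ψ).sub φ = r.sub (ψ.comp φ) := by cases r <;> rfl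

theorem sub_name {X : Type} (r : Dim X) : r.sub Dim.name = r := by cases r <;> rfl

end Dim

namespace DSub

theorem comp_assoc {X Y Z W : Type} (ψ : DSub X Y) (φ : DSub Y Z) (χ : DSub Z W) :
    (ψ.comp φ).comp χ = ψ.comp (φ.comp χ) := by
  funext x; exact Dim.sub_sub _ _ _

theorem comp_name {X Y : Type} (ψ : DSub X Y) : ψ.comp Dim.name = ψ := by
  funext x; exact Dim.sub_name _

theorem name_comp {X Y : Type} (ψ : DSub X Y) : DSub.comp Dim.name ψ = ψ := rfl

theorem wk_comp_lift {X Y : Type} (ψ : DSub X Y) : wk.comp ψ.lift = ψ.comp wk := rfl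

theorem wk_comp_inst {X : Type} (r : Dim X) : wk.comp (inst r) = Dim.name := rfl

theorem lift_name {X : Type} : lift (Dim.name : DSub X X) = Dim.name := by
  funext x; cases x <;> rfl

theorem lift_comp {X Y Z : Type} (ψ : DSub X Y) (φ : DSub Y Z) :
    (ψ.comp φ).lift = ψ.lift.comp φ.lift := by
  funext x
  cases x with
  | none => rfl
  | some x =>
    change ((ψ x).sub φ).sub wk = ((ψ x).sub wk).sub φ.lift
    rw [Dim.sub_sub, Dim.sub_sub, wk_comp_lift]

/-- A substitution out of `X, y` is determined by its restriction to `X` and its value at `y`. -/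
theorem lift_comp_inst {X Y : Type} (ψ : DSub (Option X) Y) :
    (wk.comp ψ).lift.comp (inst (ψ none)) = ψ := by
  funext x
  cases x with
  | none => rfl
  | some x =>
    change ((ψ (some x)).sub wk).sub (inst (ψ none)) = ψ (some x)
    rw [Dim.sub_sub, wk_comp_inst, Dim.sub_name]

/-- Both substitutions restrict to `ψ` on `X` and send the last name to `r.sub ψ`, which determines
them by `lift_comp_inst`. -/
theorem inst_comp {X Y : Type} (r : Dim X) (ψ : DSub X Y) :
    (inst r).comp ψ = ψ.lift.comp (inst (r.sub ψ)) := by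
  rw [← lift_comp_inst ((inst r).comp ψ)]
  rfl

end DSub

theorem Dim.wk_sub {X Y : Type} (r : Dim X) (ψ : DSub (Option X) Y) :
    r.wk.sub ψ = r.sub (DSub.wk.comp ψ) := Dim.sub_sub _ _ _

theorem Dim.sub_wk {X Y : Type} (r : Dim X) (ψ : DSub X Y) :
    (r.sub ψ).wk = r.wk.sub ψ.lift := by
  rw [Dim.wk_sub, DSub.wk_comp_lift]; exact Dim.sub_sub _ _ _

namespace Tm

theorem dsub_dsub {X : Type} {k : ℕ} (M : Tm X k) : ∀ {Y Z : Type} (ψ : DSub X Y) (φ : DSub Y Z),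
    (M.dsub ψ).dsub φ = M.dsub (ψ.comp φ) := by
  -- `Bool.forall_bool` would split the induction hypotheses on the tube faces into the cases
  -- `false` and `true`, and these no longer rewrite a face at a bound `ε`.
  induction M <;> intro Y Z ψ φ <;> simp_all [-Bool.forall_bool, dsub, DSub.lift_comp, Dim.sub_sub]

theorem dsub_name {X : Type} {k : ℕ} (M : Tm X k) : M.dsub Dim.name = M := by
  induction M <;> simp_all [-Bool.forall_bool, dsub, DSub.lift_name, Dim.sub_name]

theorem tren_dsub {X : Type} {k : ℕ} (M : Tm X k) : ∀ {l : ℕ} {Y : Type} (ρ : Fin k → Fin l)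
    (ψ : DSub X Y), (M.tren ρ).dsub ψ = (M.dsub ψ).tren ρ := by
  induction M <;> intro l Y ρ ψ <;> simp_all [-Bool.forall_bool, dsub, tren]

theorem dwk_dsub_lift {X Y : Type} {k : ℕ} (M : Tm X k) (ψ : DSub X Y) :
    M.dwk.dsub ψ.lift = (M.dsub ψ).dwk := by
  rw [dwk, dwk, dsub_dsub, dsub_dsub, DSub.wk_comp_lift]

theorem liftSub_dsub {X Y : Type} {k l : ℕ} (σ : Fin k → Tm X l) (ψ : DSub X Y) :
    (fun i => (liftSub σ i).dsub ψ) = liftSub (fun i => (σ i).dsub ψ) := by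
  funext i
  refine Fin.cases rfl (fun i => ?_) i
  exact tren_dsub _ _ _

theorem tsub_dsub {X : Type} {k : ℕ} (M : Tm X k) : ∀ {l : ℕ} {Y : Type} (σ : Fin k → Tm X l)
    (ψ : DSub X Y), (M.tsub σ).dsub ψ = (M.dsub ψ).tsub (fun i => (σ i).dsub ψ) := by
  induction M <;> intro l Y σ ψ <;> simp_all [-Bool.forall_bool, dsub, tsub, liftSub_dsub, dwk_dsub_lift]

theorem inst_dsub {X Y : Type} {l : ℕ} (M : Tm X 1) (N : Tm X l) (ψ : DSub X Y) :
    (M.inst N).dsub ψ = (M.dsub ψ).inst (N.dsub ψ) := tsub_dsub _ _ _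

theorem dwk_dsub {X Y : Type} {k : ℕ} (M : Tm X k) (ψ : DSub (Option X) Y) :
    M.dwk.dsub ψ = M.dsub (DSub.wk.comp ψ) := dsub_dsub _ _ _

theorem dwkUnder_dsub_lift {X Y : Type} {k : ℕ} (M : Tm (Option X) k) (ψ : DSub (Option X) Y) :
    M.dwkUnder.dsub ψ.lift = M.dsub (DSub.wk.comp ψ).lift := by
  rw [dwkUnder, dsub_dsub, DSub.lift_comp]

theorem dinst_dsub {X Y : Type} {k : ℕ} (M : Tm (Option X) k) (r : Dim X) (ψ : DSub X Y) :
    (M.dinst r).dsub ψ = (M.dsub ψ.lift).dinst (r.sub ψ) := by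
  rw [dinst, dinst, dsub_dsub, dsub_dsub, DSub.inst_comp]

/-- Any instance of a tube face is thus an endpoint of a restricted face, so that laws about
endpoints of tubes apply to all their instances. -/
theorem dsub_lift_dinst {X Y : Type} {k : ℕ} (M : Tm (Option X) k) (ψ : DSub (Option X) Y) :
    (M.dsub (DSub.wk.comp ψ).lift).dinst (ψ none) = M.dsub ψ := by
  rw [dinst, dsub_dsub, DSub.lift_comp_inst]

theorem inst_dwk_dsub {X Y : Type} {l : ℕ} (A : Tm X 1) (N : Tm (Option X) l)
    (ψ : DSub (Option X) Y) :
    (A.dwk.inst N).dsub ψ = (A.dsub (DSub.wk.comp ψ)).inst (N.dsub ψ) := by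
  rw [inst_dsub, dwk_dsub]

end Tm

/-! ### Determinism of evaluation -/

/-- Only composition values need an argument: their type is itself a value, having only names as
extents excludes the tube rule, and `r ≠ r'` excludes the cap rule. -/
theorem IsVal.not_step {D : Type} {V M : Tm D 0} (hV : IsVal V) : ¬ Step V M := by
  intro h
  cases hV with
  | hcom_bool rs r r' M N hrs hr =>
    cases h with
    | hcom_type _ _ _ _ _ h => cases h
    | hcom_bool_tube _ _ _ _ _ i ε _ hi =>
      obtain ⟨x, hx⟩ := hrs i
      rw [hx] at hi; cases hi
    | hcom_bool_cap _ _ _ _ _ _ h => exact hr h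
  | hcom_S1 rs r r' M N hrs hr =>
    cases h with
    | hcom_type _ _ _ _ _ h => cases h
    | hcom_S1_tube _ _ _ _ _ i ε _ hi =>
      obtain ⟨x, hx⟩ := hrs i
      rw [hx] at hi; cases hi
    | hcom_S1_cap _ _ _ _ _ _ h => exact hr h
  | _ => cases h

/-- The tube rule fires at the first constant extent, since all earlier extents are required to be
names; two such positions cannot precede one another. -/
theorem firstConst_unique {D : Type} {n : ℕ} {rs : Fin (n + 1) → Dim D} {i j : Fin (n + 1)}
    {ε ε' : Bool} (hi : ∀ k < i, (rs k).IsName) (hiε : rs i = .const ε)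
    (hj : ∀ k < j, (rs k).IsName) (hjε : rs j = .const ε') : i = j ∧ ε = ε' := by
  have hij : i = j := by
    rcases lt_trichotomy i j with h | h | h
    · obtain ⟨x, hx⟩ := hj i h
      rw [hx] at hiε; cases hiε
    · exact h
    · obtain ⟨x, hx⟩ := hi j h
      rw [hx] at hjε; cases hjε
  subst hij
  rw [hiε] at hjε
  exact ⟨rfl, Dim.const.inj hjε⟩

theorem not_isName_of_const {D : Type} {r : Dim D} {ε : Bool} (h : r = .const ε) : ¬ r.IsName := by
  rintro ⟨x, hx⟩
  rw [hx] at h; cases h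

/-- The flip rule carries the index `!ε`, which case analysis cannot unify with a given constant.
Treating both endpoints as arbitrary constants lets one formula cover the flip and the identity
rule, which exclude each other because `ε ≠ !ε`. -/
theorem Step.coe_notb_const {D : Type} {ε ε' : Bool} {M N : Tm D 0}
    (h : Step (.coe (.notb (.name none)) (.const ε) (.const ε') M) N) :
    N = if ε = ε' then M else M.notf := by
  generalize hX : Tm.coe (.notb (.name none)) (.const ε) (.const ε') M = X at h
  cases h with
  | coe_type _ _ _ h => cases hX; cases h
  | coe_notb_flip δ =>
    simp only [Tm.coe.injEq, Dim.const.injEq, true_and] at hX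
    obtain ⟨rfl, rfl, rfl⟩ := hX
    simp
  | coe_notb_same => cases hX; simp
  | _ => cases hX

/-- A rule that evaluates a principal argument could only compete with a rule that needs this
argument to be a value, and values do not step. Otherwise only the tube and cap rules and the
coercions between constants along `not` need care. -/
theorem Step.deterministic {D : Type} {M N : Tm D 0} (h : Step M N) :
    ∀ {N' : Tm D 0}, Step M N' → N = N' := by
  induction h with
  | hcom_bool_tube rs r r' M N i ε hi hiε =>
    intro N' h'
    cases h' with
    | hcom_type _ _ _ _ _ h => cases h
    | hcom_bool_tube _ _ _ _ _ j ε' hj hjε =>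
      obtain ⟨rfl, rfl⟩ := firstConst_unique hi hiε hj hjε
      rfl
    | hcom_bool_cap _ _ _ _ _ h _ => exact absurd (h i) (not_isName_of_const hiε)
  | hcom_S1_tube rs r r' M N i ε hi hiε =>
    intro N' h'
    cases h' with
    | hcom_type _ _ _ _ _ h => cases h
    | hcom_S1_tube _ _ _ _ _ j ε' hj hjε =>
      obtain ⟨rfl, rfl⟩ := firstConst_unique hi hiε hj hjε
      rfl
    | hcom_S1_cap _ _ _ _ _ h _ => exact absurd (h i) (not_isName_of_const hiε)
  | hcom_bool_cap rs r r' M N hrs hr =>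
    intro N' h'
    cases h' with
    | hcom_type _ _ _ _ _ h => cases h
    | hcom_bool_tube _ _ _ _ _ j ε' hj hjε => exact absurd (hrs j) (not_isName_of_const hjε)
    | hcom_bool_cap _ _ _ _ _ h _ => rfl
  | hcom_S1_cap rs r r' M N hrs hr =>
    intro N' h'
    cases h' with
    | hcom_type _ _ _ _ _ h => cases h
    | hcom_S1_tube _ _ _ _ _ j ε' hj hjε => exact absurd (hrs j) (not_isName_of_const hjε)
    | hcom_S1_cap _ _ _ _ _ h _ => rfl
  | if_hcom A rs r r' M N T F hrs hr =>
    intro N' h'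
    cases h' with
    | if_arg _ _ _ h => exact absurd h (IsVal.hcom_bool rs r r' M N hrs hr).not_step
    | if_hcom => rfl
  | S1elim_hcom A rs r r' M N P L hrs hr =>
    intro N' h'
    cases h' with
    | S1elim_arg _ _ _ h => exact absurd h (IsVal.hcom_S1 rs r r' M N hrs hr).not_step
    | S1elim_hcom => rfl
  | if_arg A T F h ih =>
    intro N' h'
    cases h' with
    | if_arg _ _ _ h' => rw [ih h']
    | if_tt => cases h
    | if_ff => cases h
    | if_hcom A rs r r' M N T F hrs hr =>
      exact absurd h (IsVal.hcom_bool rs r r' M N hrs hr).not_step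
  | S1elim_arg A P L h ih =>
    intro N' h'
    cases h' with
    | S1elim_arg _ _ _ h' => rw [ih h']
    | S1elim_base => cases h
    | S1elim_loop => cases h
    | S1elim_hcom A rs r r' M N T F hrs hr =>
      exact absurd h (IsVal.hcom_S1 rs r r' M N hrs hr).not_step
  | hcom_type rs r r' M N h ih =>
    intro N' h'
    cases h' with
    | hcom_type _ _ _ _ _ h' => rw [ih h']
    | _ => cases h
  | coe_type r r' M h ih =>
    intro N' h'
    cases h' with
    | coe_type _ _ _ h' => rw [ih h']
    | _ => cases h
  | coe_notb_flip ε M =>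
    intro N' h'
    rw [h'.coe_notb_const]; simp
  | coe_notb_same ε M =>
    intro N' h'
    rw [h'.coe_notb_const]; simp
  | coe_notb_arg x r h ih =>
    intro N' h'
    cases h' with
    | coe_type _ _ _ h' => cases h'
    | coe_notb_arg _ _ h' => rw [ih h']
    | coe_notb_notel => cases h
  | coe_notb_notel x r M =>
    intro N' h'
    cases h' with
    | coe_type _ _ _ h' => cases h'
    | coe_notb_arg _ _ h' => cases h'
    | coe_notb_notel => rfl
  | _ =>
    intro N' h'
    cases h' <;> first
      | rfl
      | (rename_i ih _ h'; rw [ih h'])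
      | (rename_i h'; cases h')
      | (rename_i h _; cases h)

theorem Eval.deterministic {D : Type} {M V W : Tm D 0} (hV : Eval M V) (hW : Eval M W) :
    V = W := by
  obtain ⟨hMV, hV⟩ := hV
  obtain ⟨hMW, hW⟩ := hW
  induction hMV using Relation.ReflTransGen.head_induction_on with
  | refl =>
    rcases hMW.cases_head with h | ⟨P, h, _⟩
    · exact h
    · exact absurd h hV.not_step
  | head h _ ih =>
    rcases hMW.cases_head with rfl | ⟨P, h', hP⟩
    · exact absurd h hW.not_step
    · exact ih (h.deterministic h' ▸ hP)

theorem IsVal.eval {D : Type} {V : Tm D 0} (hV : IsVal V) : Eval V V := ⟨.refl, hV⟩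

theorem Eval.head {D : Type} {M N V : Tm D 0} (h : Relation.ReflTransGen Step M N)
    (hN : Eval N V) : Eval M V := ⟨h.trans hN.1, hN.2⟩

theorem Tm.ifb_steps {D : Type} (A : Tm D 1) {M N : Tm D 0} (T F : Tm D 0)
    (h : Relation.ReflTransGen Step M N) :
    Relation.ReflTransGen Step (.ifb A M T F) (.ifb A N T F) :=
  h.lift (fun M => Tm.ifb A M T F) fun _ _ h => .if_arg A T F h


/-! ### Coherent aspects -/

theorem RelFour.swap {α : Type*} {R : α → α → Prop} {a b c d : α} (h : RelFour R a b c d) :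
    RelFour R c d a b := by
  intro x hx y hy
  refine h x ?_ y ?_ <;> simp only [List.mem_cons, List.not_mem_nil, or_false] at hx hy ⊢ <;> tauto

theorem RelFour.trans {α : Type*} {R : α → α → Prop} {a b c d e f : α}
    (ht : ∀ {x y z}, R x y → R y z → R x z) (h : RelFour R a b c d) (h' : RelFour R c d e f) :
    RelFour R a b e f := by
  intro x hx y hy
  simp only [List.mem_cons, List.not_mem_nil, or_false] at hx hy
  have hl : ∀ z, z = a ∨ z = b → R z c ∧ R c z := fun z hz => by
    rcases hz with rfl | rfl <;> exact ⟨h _ (by simp) _ (by simp), h _ (by simp) _ (by simp)⟩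
  have hr : ∀ z, z = e ∨ z = f → R z c ∧ R c z := fun z hz => by
    rcases hz with rfl | rfl <;> exact ⟨h' _ (by simp) _ (by simp), h' _ (by simp) _ (by simp)⟩
  have hb : ∀ z, z = a ∨ z = b ∨ z = e ∨ z = f → R z c ∧ R c z := fun z hz => by
    rcases hz with h | h | h | h
    · exact hl z (.inl h)
    · exact hl z (.inr h)
    · exact hr z (.inl h)
    · exact hr z (.inr h)
  exact ht (hb x hx).1 (hb y hy).2

/-- Each of the four is related to `b` along the chain `a, b, d, c`. For aspects, the outer links
are the stability of either term and the middle link compares the two terms. -/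
theorem RelFour.of_chain {α : Type*} {R : α → α → Prop} {a b c d : α}
    (hs : ∀ {x y}, R x y → R y x) (ht : ∀ {x y z}, R x y → R y z → R x z)
    (hab : R a b) (hbd : R b d) (hcd : R c d) : RelFour R a b c d := by
  have hall : ∀ z ∈ [a, b, c, d], R z b := by
    intro z hz
    simp only [List.mem_cons, List.not_mem_nil, or_false] at hz
    rcases hz with rfl | rfl | rfl | rfl
    · exact hab
    · exact ht (hs hab) hab
    · exact ht hcd (hs hbd)
    · exact hs hbd
  exact fun x hx y hy => ht (hall x hx) (hs (hall y hy))

namespace Coherent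

variable {Ψ : Ctx} {R S : (Ψ₂ : Ctx) → DSub Ψ Ψ₂ → CTm Ψ₂ → CTm Ψ₂ → Prop} {M N O : CTm Ψ}

theorem mono (h : Coherent R M N) (hRS : ∀ Ψ₂ ψ V W, R Ψ₂ ψ V W → S Ψ₂ ψ V W) :
    Coherent S M N := by
  intro Ψ₁ ψ₁ Ψ₂ ψ₂
  obtain ⟨M₁, M₂, M₁₂, N₁, N₂, N₁₂, hM, hN, hR⟩ := h Ψ₁ ψ₁ Ψ₂ ψ₂
  exact ⟨M₁, M₂, M₁₂, N₁, N₂, N₁₂, hM, hN, fun x hx y hy => hRS _ _ _ _ (hR x hx y hy)⟩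

theorem symm (h : Coherent R M N) : Coherent R N M := by
  intro Ψ₁ ψ₁ Ψ₂ ψ₂
  obtain ⟨M₁, M₂, M₁₂, N₁, N₂, N₁₂, hM, hN, hR⟩ := h Ψ₁ ψ₁ Ψ₂ ψ₂
  exact ⟨N₁, N₂, N₁₂, M₁, M₂, M₁₂, hN, hM, hR.swap⟩

theorem trans (ht : ∀ Ψ₂ ψ {V W U}, R Ψ₂ ψ V W → R Ψ₂ ψ W U → R Ψ₂ ψ V U)
    (h : Coherent R M N) (h' : Coherent R N O) : Coherent R M O := by
  intro Ψ₁ ψ₁ Ψ₂ ψ₂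
  obtain ⟨M₁, M₂, M₁₂, N₁, N₂, N₁₂, hM, hN, hR⟩ := h Ψ₁ ψ₁ Ψ₂ ψ₂
  obtain ⟨N₁', N₂', N₁₂', O₁, O₂, O₁₂, hN', hO, hR'⟩ := h' Ψ₁ ψ₁ Ψ₂ ψ₂
  obtain rfl := hN.1.deterministic hN'.1
  obtain rfl := hN.2.1.deterministic hN'.2.1
  obtain rfl := hN.2.2.deterministic hN'.2.2
  exact ⟨M₁, M₂, M₁₂, O₁, O₂, O₁₂, hM, hO, hR.trans (ht _ _) hR'⟩

theorem dsub (h : Coherent R M N) {Ψ' : Ctx} (ψ : DSub Ψ Ψ') :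
    Coherent (fun Ψ₂ φ => R Ψ₂ (ψ.comp φ)) (M.dsub ψ) (N.dsub ψ) := by
  intro Ψ₁ ψ₁ Ψ₂ ψ₂
  rw [Tm.dsub_dsub, Tm.dsub_dsub, Tm.dsub_dsub, Tm.dsub_dsub]
  simpa only [DSub.comp_assoc] using h Ψ₁ (ψ.comp ψ₁) Ψ₂ ψ₂

/-- The values of coherent terms are related, and are stable under evaluation. -/
theorem eval (h : Coherent R M N) : ∃ V W, Eval M V ∧ Eval N W ∧ R Ψ Dim.name V W ∧
    R Ψ Dim.name V V ∧
    ∀ (Ψ' : Ctx) (ψ : DSub Ψ Ψ'), ∃ V₂ W₂ M' N', Eval (V.dsub ψ) V₂ ∧ Eval (W.dsub ψ) W₂ ∧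
      Eval (M.dsub ψ) M' ∧ Eval (N.dsub ψ) N' ∧ RelFour (R Ψ' ψ) V₂ M' W₂ N' := by
  -- With both substitutions the identity, the aspects of the composite are the values themselves;
  -- the stability part below keeps only the first one trivial.
  obtain ⟨V, _, M', W, _, N', ⟨hV, -, hM⟩, ⟨hW, -, hN⟩, hR⟩ := h Ψ Dim.name Ψ Dim.name
  rw [Tm.dsub_name] at hV hW
  rw [DSub.comp_name] at hM hN hR
  rw [Tm.dsub_name] at hM hN
  obtain rfl := hV.deterministic hM
  obtain rfl := hW.deterministic hN
  refine ⟨_, _, hV, hW, hR _ (by simp) _ (by simp), hR _ (by simp) _ (by simp), ?_⟩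
  intro Ψ' ψ
  obtain ⟨M₁, M₂, M₁₂, N₁, N₂, N₁₂, hM', hN', hR'⟩ := h Ψ Dim.name Ψ' ψ
  rw [DSub.name_comp] at hM' hN' hR'
  rw [Tm.dsub_name] at hM' hN'
  obtain rfl := hV.deterministic hM'.1
  obtain rfl := hW.deterministic hN'.1
  exact ⟨_, _, _, _, hM'.2.1, hN'.2.1, hM'.2.2, hN'.2.2, hR'⟩

end Coherent

namespace CTS

variable {ts : CTS} {Ψ : Ctx} {A B C M N O P : CTm Ψ}

/-! ### Equality of pretypes -/

theorem EqPretype.symm (h : ts.EqPretype Ψ A B) : ts.EqPretype Ψ B A := Coherent.symm h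

theorem EqPretype.trans (h : ts.EqPretype Ψ A B) (h' : ts.EqPretype Ψ B C) :
    ts.EqPretype Ψ A C :=
  Coherent.trans (fun _ _ => ts.E_trans) h h'

theorem EqPretype.right (h : ts.EqPretype Ψ A B) : ts.EqPretype Ψ B B := h.symm.trans h

theorem EqPretype.dsub (h : ts.EqPretype Ψ A B) {Ψ' : Ctx} (ψ : DSub Ψ Ψ') :
    ts.EqPretype Ψ' (A.dsub ψ) (B.dsub ψ) := Coherent.dsub h ψ

theorem EqPretype.eval (h : ts.EqPretype Ψ A B) :
    ∃ A₀ B₀, Eval A A₀ ∧ Eval B B₀ ∧ ts.E Ψ A₀ B₀ := by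
  obtain ⟨V, W, hV, hW, hR, -⟩ := Coherent.eval h
  exact ⟨V, W, hV, hW, hR⟩

/-! ### Equality of values of terms -/

/-- `M` and `N` evaluate to values that are related at the value of `A`. -/
def EqVal (ts : CTS) (Ψ : Ctx) (M N A : CTm Ψ) : Prop :=
  ∃ A₀ V W, Eval A A₀ ∧ Eval M V ∧ Eval N W ∧ ts.Φ Ψ A₀ V W

theorem EqVal.symm (hA : ts.EqPretype Ψ A A) (h : ts.EqVal Ψ M N A) : ts.EqVal Ψ N M A := by
  obtain ⟨A₀, V, W, hA₀, hV, hW, h⟩ := h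
  obtain ⟨A₁, A₂, hA₁, hA₂, hE⟩ := hA.eval
  obtain rfl := hA₀.deterministic hA₁
  obtain rfl := hA₀.deterministic hA₂
  exact ⟨_, W, V, hA₀, hW, hV, ts.Φ_symm hE h⟩

theorem EqVal.trans (hA : ts.EqPretype Ψ A A) (h : ts.EqVal Ψ M N A) (h' : ts.EqVal Ψ N O A) :
    ts.EqVal Ψ M O A := by
  obtain ⟨A₀, V, W, hA₀, hV, hW, h⟩ := h
  obtain ⟨A₀', W', U, hA₀', hW', hU, h'⟩ := h'
  obtain ⟨A₁, A₂, hA₁, hA₂, hE⟩ := hA.eval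
  obtain rfl := hA₀.deterministic hA₁
  obtain rfl := hA₀.deterministic hA₂
  obtain rfl := hA₀.deterministic hA₀'
  obtain rfl := hW.deterministic hW'
  exact ⟨_, V, U, hA₀, hV, hU, ts.Φ_trans hE h h'⟩

theorem EqVal.conv (hAB : ts.EqPretype Ψ A B) (h : ts.EqVal Ψ M N A) : ts.EqVal Ψ M N B := by
  obtain ⟨A₀, V, W, hA₀, hV, hW, h⟩ := h
  obtain ⟨A₁, B₀, hA₁, hB₀, hE⟩ := hAB.eval
  obtain rfl := hA₀.deterministic hA₁
  exact ⟨B₀, V, W, hB₀, hV, hW, (ts.Φ_resp hE).1 h⟩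

theorem EqVal.head {M' N' : CTm Ψ} (hM : Relation.ReflTransGen Step M M')
    (hN : Relation.ReflTransGen Step N N') (h : ts.EqVal Ψ M' N' A) : ts.EqVal Ψ M N A := by
  obtain ⟨A₀, V, W, hA₀, hV, hW, h⟩ := h
  exact ⟨A₀, V, W, hA₀, hV.head hM, hW.head hN, h⟩

/-! ### Equality of terms -/

theorem EqTm.symm (h : ts.EqTm Ψ M N A) : ts.EqTm Ψ N M A := ⟨h.1, Coherent.symm h.2⟩

theorem EqTm.dsub (h : ts.EqTm Ψ M N A) {Ψ' : Ctx} (ψ : DSub Ψ Ψ') :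
    ts.EqTm Ψ' (M.dsub ψ) (N.dsub ψ) (A.dsub ψ) :=
  ⟨h.1.dsub ψ, (Coherent.dsub h.2 ψ).mono fun _ φ _ _ ⟨A₁₂, hA, hΦ⟩ =>
    ⟨A₁₂, by rwa [Tm.dsub_dsub], hΦ⟩⟩

theorem EqTm.trans (h : ts.EqTm Ψ M N A) (h' : ts.EqTm Ψ N O A) : ts.EqTm Ψ M O A := by
  refine ⟨h.1, Coherent.trans (fun Ψ₂ ψ V W U => ?_) h.2 h'.2⟩
  rintro ⟨A₁, hA₁, h₁⟩ ⟨A₂, hA₂, h₂⟩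
  obtain ⟨A₃, A₄, hA₃, hA₄, hE⟩ := (h.1.dsub ψ).eval
  obtain rfl := hA₁.deterministic hA₂
  obtain rfl := hA₁.deterministic hA₃
  obtain rfl := hA₁.deterministic hA₄
  exact ⟨_, hA₁, ts.Φ_trans hE h₁ h₂⟩

theorem EqTm.left (h : ts.EqTm Ψ M N A) : ts.EqTm Ψ M M A := h.trans h.symm

theorem EqTm.right (h : ts.EqTm Ψ M N A) : ts.EqTm Ψ N N A := h.symm.trans h

theorem EqTm.conv (h : ts.EqTm Ψ M N A) (hAB : ts.EqPretype Ψ A B) : ts.EqTm Ψ M N B := by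
  refine ⟨hAB.right, Coherent.mono h.2 fun Ψ₂ ψ V W ⟨A₁₂, hA, hΦ⟩ => ?_⟩
  obtain ⟨A₁, B₀, hA₁, hB₀, hE⟩ := (hAB.dsub ψ).eval
  obtain rfl := hA.deterministic hA₁
  exact ⟨B₀, hB₀, (ts.Φ_resp hE).1 hΦ⟩

/-- The value of `M` is stable under evaluation, up to equality of values in `A`. -/
def StableVal (ts : CTS) (Ψ : Ctx) (M A : CTm Ψ) : Prop :=
  ∃ V, Eval M V ∧ ∀ (Ψ' : Ctx) (ψ : DSub Ψ Ψ'),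
    ts.EqVal Ψ' (V.dsub ψ) (M.dsub ψ) (A.dsub ψ)

theorem EqTm.eqVal (h : ts.EqTm Ψ M N A) : ts.EqVal Ψ M N A := by
  obtain ⟨V, W, hV, hW, ⟨A₀, hA₀, hR⟩, -⟩ := Coherent.eval h.2
  rw [Tm.dsub_name] at hA₀
  exact ⟨A₀, V, W, hA₀, hV, hW, hR⟩

theorem EqTm.stableVal (h : ts.EqTm Ψ M N A) : ts.StableVal Ψ M A := by
  obtain ⟨V, W, hV, hW, -, -, hR⟩ := Coherent.eval h.2
  refine ⟨V, hV, fun Ψ' ψ => ?_⟩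
  obtain ⟨V₂, W₂, M', N', hV₂, -, hM', -, hR⟩ := hR Ψ' ψ
  obtain ⟨A₀, hA₀, hΦ⟩ := hR V₂ (by simp) M' (by simp)
  exact ⟨A₀, V₂, M', hA₀, hV₂, hM', hΦ⟩

/-- `M` and `M'` share a value, but an instance of `M` need not evaluate to the same instance of
`M'`; the last hypothesis bridges this gap. -/
theorem StableVal.head {M' : CTm Ψ} (hA : ts.EqPretype Ψ A A)
    (hM : Relation.ReflTransGen Step M M') (h : ts.StableVal Ψ M' A)
    (h' : ∀ (Ψ' : Ctx) (ψ : DSub Ψ Ψ'), ts.EqVal Ψ' (M'.dsub ψ) (M.dsub ψ) (A.dsub ψ)) :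
    ts.StableVal Ψ M A := by
  obtain ⟨V, hV, hst⟩ := h
  exact ⟨V, hV.head hM, fun Ψ' ψ => (hst Ψ' ψ).trans (hA.dsub ψ) (h' Ψ' ψ)⟩

/-- The aspects form a chain `M₂, M₁₂, N₁₂, N₂`: stability of `M` and of `N` supplies the two ends
and equality of values under the composite substitution the middle. No link between `M₂` and `N₂`
has to be checked directly. -/
theorem EqTm.of_eqVal (hA : ts.EqPretype Ψ A A)
    (hMN : ∀ (Ψ' : Ctx) (ψ : DSub Ψ Ψ'), ts.EqVal Ψ' (M.dsub ψ) (N.dsub ψ) (A.dsub ψ))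
    (hM : ∀ (Ψ' : Ctx) (ψ : DSub Ψ Ψ'), ts.StableVal Ψ' (M.dsub ψ) (A.dsub ψ))
    (hN : ∀ (Ψ' : Ctx) (ψ : DSub Ψ Ψ'), ts.StableVal Ψ' (N.dsub ψ) (A.dsub ψ)) :
    ts.EqTm Ψ M N A := by
  refine ⟨hA, fun Ψ₁ ψ₁ Ψ₂ ψ₂ => ?_⟩
  obtain ⟨M₁, hM₁, hM⟩ := hM Ψ₁ ψ₁
  obtain ⟨N₁, hN₁, hN⟩ := hN Ψ₁ ψ₁
  obtain ⟨A₀, M₂, M₁₂, hA₀, hM₂, hM₁₂, hM⟩ := hM Ψ₂ ψ₂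
  obtain ⟨A₁, N₂, N₁₂, hA₁, hN₂, hN₁₂, hN⟩ := hN Ψ₂ ψ₂
  obtain ⟨A₂, M₃, N₃, hA₂, hM₃, hN₃, hMN⟩ := hMN Ψ₂ (ψ₁.comp ψ₂)
  obtain ⟨A₃, A₄, hA₃, hA₄, hE⟩ := (hA.dsub (ψ₁.comp ψ₂)).eval
  rw [Tm.dsub_dsub] at hA₀ hA₁ hM₁₂ hN₁₂
  obtain rfl := hA₀.deterministic hA₁
  obtain rfl := hA₀.deterministic hA₂
  obtain rfl := hA₀.deterministic hA₃
  obtain rfl := hA₀.deterministic hA₄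
  obtain rfl := hM₁₂.deterministic hM₃
  obtain rfl := hN₁₂.deterministic hN₃
  refine ⟨M₁, M₂, _, N₁, N₂, _, ⟨hM₁, hM₂, hM₁₂⟩, ⟨hN₁, hN₂, hN₁₂⟩, ?_⟩
  have hfour := RelFour.of_chain (R := ts.Φ Ψ₂ A₀) (ts.Φ_symm hE) (ts.Φ_trans hE) hM hMN hN
  exact fun x hx y hy => ⟨A₀, hA₀, hfour x hx y hy⟩

theorem StableVal.conv (hAB : ts.EqPretype Ψ A B) (h : ts.StableVal Ψ M A) :
    ts.StableVal Ψ M B := by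
  obtain ⟨V, hV, hst⟩ := h
  exact ⟨V, hV, fun Ψ' ψ => (hst Ψ' ψ).conv (hAB.dsub ψ)⟩

/-- Stability of the value of `M` says precisely that `V` and `M` have related values at every
instance. That `V` is itself an element comes from cubicality in the applications. -/
theorem EqTm.of_eval {V : CTm Ψ} (hM : ts.EqTm Ψ M M A) (hMV : Eval M V)
    (hV : ts.EqTm Ψ V V A) : ts.EqTm Ψ V M A := by
  obtain ⟨W, hW, hst⟩ := hM.stableVal
  obtain rfl := hMV.deterministic hW
  exact .of_eqVal hM.1 hst (fun Ψ' ψ => (hV.dsub ψ).stableVal) fun Ψ' ψ => (hM.dsub ψ).stableVal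

/-- Coherent expansion: if every instance of `M` evaluates to a term that is equal to the
corresponding instance of `O`, then `M` and `O` are equal. -/
theorem EqTm.expand (hO : ts.EqTm Ψ O O A)
    (h : ∀ (Ψ' : Ctx) (ψ : DSub Ψ Ψ'), ∃ P, Relation.ReflTransGen Step (M.dsub ψ) P ∧
      ts.EqTm Ψ' P (O.dsub ψ) (A.dsub ψ)) : ts.EqTm Ψ M O A := by
  have hMO : ∀ (Ψ' : Ctx) (ψ : DSub Ψ Ψ'), ts.EqVal Ψ' (M.dsub ψ) (O.dsub ψ) (A.dsub ψ) := by
    intro Ψ' ψ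
    obtain ⟨P, hP, hPO⟩ := h Ψ' ψ
    exact hPO.eqVal.head hP .refl
  refine .of_eqVal hO.1 hMO (fun Ψ' ψ => ?_) (fun Ψ' ψ => (hO.dsub ψ).stableVal)
  obtain ⟨P, hP, hPO⟩ := h Ψ' ψ
  -- Instances of the reduct `P` are compared with those of `M` through `O`: `P` equals `O` by
  -- hypothesis, and `O` has the values of `M` by `hMO`.
  refine .head (hO.1.dsub ψ) hP hPO.stableVal fun Ψ₂ φ => ?_
  refine (hPO.dsub φ).eqVal.trans ((hO.1.dsub ψ).dsub φ) ?_
  simp only [Tm.dsub_dsub]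
  exact (hMO Ψ₂ (ψ.comp φ)).symm (hO.1.dsub _)

end CTS

/-! ### Premises of compositions -/

/-- A family of partial equivalence relations, indexed by the instances of `Ψ`, that is stable under
dimension substitution. -/
structure StablePER {Ψ : Ctx} (Q : (Ψ' : Ctx) → DSub Ψ Ψ' → CTm Ψ' → CTm Ψ' → Prop) : Prop where
  symm : ∀ {Ψ' ψ M N}, Q Ψ' ψ M N → Q Ψ' ψ N M
  trans : ∀ {Ψ' ψ M N O}, Q Ψ' ψ M N → Q Ψ' ψ N O → Q Ψ' ψ M O
  dsub : ∀ {Ψ' ψ M N}, Q Ψ' ψ M N → ∀ {Ψ₂ : Ctx} (φ : DSub Ψ' Ψ₂),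
    Q Ψ₂ (ψ.comp φ) (M.dsub φ) (N.dsub φ)

/-- The premises of the equality of two compositions, equality being read as `Q`. -/
structure CompPrem {Ψ : Ctx} (Q : (Ψ' : Ctx) → DSub Ψ Ψ' → CTm Ψ' → CTm Ψ' → Prop) {n : ℕ}
    (rs : Fin (n + 1) → Dim Ψ) (r : Dim Ψ) (M O : CTm Ψ)
    (N P : Fin (n + 1) → Bool → Tm (Option Ψ) 0) : Prop where
  cap : Q Ψ Dim.name M O
  adj : ∀ (i j : Fin (n + 1)) (ε ε' : Bool) (Ψ' : Ctx) (ψ : DSub (Option Ψ) Ψ'),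
    (rs i).wk.sub ψ = .const ε → (rs j).wk.sub ψ = .const ε' →
    Q Ψ' (DSub.wk.comp ψ) ((N i ε).dsub ψ) ((N j ε').dsub ψ)
  tube : ∀ (i : Fin (n + 1)) (ε : Bool) (Ψ' : Ctx) (ψ : DSub (Option Ψ) Ψ'),
    (rs i).wk.sub ψ = .const ε → Q Ψ' (DSub.wk.comp ψ) ((N i ε).dsub ψ) ((P i ε).dsub ψ)
  start : ∀ (i : Fin (n + 1)) (ε : Bool) (Ψ' : Ctx) (ψ : DSub Ψ Ψ'),
    (rs i).sub ψ = .const ε → Q Ψ' ψ (((N i ε).dinst r).dsub ψ) (M.dsub ψ)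

namespace CompPrem

variable {Ψ : Ctx} {Q S : (Ψ' : Ctx) → DSub Ψ Ψ' → CTm Ψ' → CTm Ψ' → Prop} {n : ℕ}
  {rs : Fin (n + 1) → Dim Ψ} {r : Dim Ψ} {M O : CTm Ψ}
  {N P : Fin (n + 1) → Bool → Tm (Option Ψ) 0}

theorem mono (h : CompPrem Q rs r M O N P) (hQS : ∀ Ψ' ψ M N, Q Ψ' ψ M N → S Ψ' ψ M N) :
    CompPrem S rs r M O N P where
  cap := hQS _ _ _ _ h.cap
  adj i j ε ε' Ψ' ψ hi hj := hQS _ _ _ _ (h.adj i j ε ε' Ψ' ψ hi hj)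
  tube i ε Ψ' ψ hi := hQS _ _ _ _ (h.tube i ε Ψ' ψ hi)
  start i ε Ψ' ψ hi := hQS _ _ _ _ (h.start i ε Ψ' ψ hi)

theorem wk_sub_inst_comp {Ψ' : Ctx} (s r : Dim Ψ) (ψ : DSub Ψ Ψ') :
    s.wk.sub ((DSub.inst r).comp ψ) = s.sub ψ := by
  rw [Dim.wk_sub]; rfl

/-- The tube faces over a common restriction agree at every `s`. -/
theorem adj_dinst (h : CompPrem Q rs r M O N P) {i j : Fin (n + 1)} {ε ε' : Bool} (s : Dim Ψ)
    {Ψ' : Ctx} {ψ : DSub Ψ Ψ'} (hi : (rs i).sub ψ = .const ε) (hj : (rs j).sub ψ = .const ε') :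
    Q Ψ' ψ (((N i ε).dinst s).dsub ψ) (((N j ε').dinst s).dsub ψ) := by
  rw [Tm.dinst, Tm.dinst, Tm.dsub_dsub, Tm.dsub_dsub]
  exact h.adj i j ε ε' Ψ' ((DSub.inst s).comp ψ) (by rwa [wk_sub_inst_comp])
    (by rwa [wk_sub_inst_comp])

theorem tube_dinst (h : CompPrem Q rs r M O N P) {i : Fin (n + 1)} {ε : Bool} (s : Dim Ψ)
    {Ψ' : Ctx} {ψ : DSub Ψ Ψ'} (hi : (rs i).sub ψ = .const ε) :
    Q Ψ' ψ (((N i ε).dinst s).dsub ψ) (((P i ε).dinst s).dsub ψ) := by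
  rw [Tm.dinst, Tm.dinst, Tm.dsub_dsub, Tm.dsub_dsub]
  exact h.tube i ε Ψ' ((DSub.inst s).comp ψ) (by rwa [wk_sub_inst_comp])

/-- Adjacency of the faces of `P` and their agreement with `O` are transported through the faces of
`N` and the cap `M`. -/
theorem symm (hQ : StablePER Q) (h : CompPrem Q rs r M O N P) : CompPrem Q rs r O M P N where
  cap := hQ.symm h.cap
  adj i j ε ε' Ψ' ψ hi hj :=
    hQ.trans (hQ.symm (h.tube i ε Ψ' ψ hi))
      (hQ.trans (h.adj i j ε ε' Ψ' ψ hi hj) (h.tube j ε' Ψ' ψ hj))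
  tube i ε Ψ' ψ hi := hQ.symm (h.tube i ε Ψ' ψ hi)
  start i ε Ψ' ψ hi :=
    hQ.trans (hQ.symm (h.tube_dinst r hi)) (hQ.trans (h.start i ε Ψ' ψ hi) (hQ.dsub h.cap ψ))

theorem left (hQ : StablePER Q) (h : CompPrem Q rs r M O N P) : CompPrem Q rs r M M N N where
  cap := hQ.trans h.cap (hQ.symm h.cap)
  adj := h.adj
  -- Reflexivity of a face is its adjacency with itself.
  tube i ε Ψ' ψ hi := h.adj i i ε ε Ψ' ψ hi hi
  start := h.start

theorem right (hQ : StablePER Q) (h : CompPrem Q rs r M O N P) : CompPrem Q rs r O O P P :=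
  (h.symm hQ).left hQ

/-- The restricted equations already range over all instances, so an instance of an instance is
covered by composing substitutions; only the cap uses stability of `Q`. -/
theorem dsub (hQ : StablePER Q) (h : CompPrem Q rs r M O N P) {Ψ' : Ctx} (ψ : DSub Ψ Ψ') :
    CompPrem (fun Ψ₂ φ => Q Ψ₂ (ψ.comp φ)) (fun i => (rs i).sub ψ) (r.sub ψ) (M.dsub ψ)
      (O.dsub ψ) (fun i ε => (N i ε).dsub ψ.lift) (fun i ε => (P i ε).dsub ψ.lift) where
  cap := by
    rw [DSub.comp_name]; exact hQ.dsub h.cap ψ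
  adj i j ε ε' Ψ₂ φ hi hj := by
    rw [Dim.sub_wk, Dim.sub_sub] at hi hj
    rw [Tm.dsub_dsub, Tm.dsub_dsub]
    have := h.adj i j ε ε' Ψ₂ (ψ.lift.comp φ) hi hj
    rwa [← DSub.comp_assoc, DSub.wk_comp_lift, DSub.comp_assoc] at this
  tube i ε Ψ₂ φ hi := by
    rw [Dim.sub_wk, Dim.sub_sub] at hi
    rw [Tm.dsub_dsub, Tm.dsub_dsub]
    have := h.tube i ε Ψ₂ (ψ.lift.comp φ) hi
    rwa [← DSub.comp_assoc, DSub.wk_comp_lift, DSub.comp_assoc] at this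
  start i ε Ψ₂ φ hi := by
    rw [Dim.sub_sub] at hi
    rw [← Tm.dinst_dsub, Tm.dsub_dsub, Tm.dsub_dsub]
    exact h.start i ε Ψ₂ (ψ.comp φ) hi

end CompPrem

namespace CTS

variable {ts : CTS} {Ψ : Ctx} {A B C : CTm Ψ}

/-- Equality of terms at the instances of a type. -/
def InType (ts : CTS) {Ψ : Ctx} (A : CTm Ψ) (Ψ' : Ctx) (ψ : DSub Ψ Ψ') (M N : CTm Ψ') : Prop :=
  ts.EqTm Ψ' M N (A.dsub ψ)

theorem stablePER_inType (ts : CTS) (A : CTm Ψ) : StablePER (ts.InType A) where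
  symm h := h.symm
  trans h h' := EqTm.trans h h'
  dsub h _ φ := by
    have := EqTm.dsub h φ
    rwa [Tm.dsub_dsub] at this

theorem satisfies_one {X Y : Type} {ψ : DSub X Y} {a b : Dim X} :
    Satisfies ψ [(a, b)] ↔ a.sub ψ = b.sub ψ := by simp [Satisfies]

theorem satisfies_two {X Y : Type} {ψ : DSub X Y} {a b c d : Dim X} :
    Satisfies ψ [(a, b), (c, d)] ↔ a.sub ψ = b.sub ψ ∧ c.sub ψ = d.sub ψ := by simp [Satisfies]

theorem compPrem_inType_iff {n : ℕ} {rs : Fin (n + 1) → Dim Ψ} {r : Dim Ψ} {M O : CTm Ψ}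
    {N P : Fin (n + 1) → Bool → Tm (Option Ψ) 0} :
    CompPrem (ts.InType A) rs r M O N P ↔
      ts.EqTm Ψ M O A ∧ ts.TubesAdjacent rs N A ∧ ts.TubesEq rs N P A ∧
        ts.CapMatches rs r N M A := by
  constructor
  · intro h
    refine ⟨?_, ?_, ?_, ?_⟩
    · have := h.cap
      rwa [InType, Tm.dsub_name] at this
    · intro i j ε ε' Ψ' ψ hψ
      rw [satisfies_two] at hψ
      rw [Tm.dwk_dsub]
      exact h.adj i j ε ε' Ψ' ψ hψ.1 hψ.2
    · intro i ε Ψ' ψ hψ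
      rw [satisfies_one] at hψ
      rw [Tm.dwk_dsub]
      exact h.tube i ε Ψ' ψ hψ
    · intro i ε Ψ' ψ hψ
      rw [satisfies_one] at hψ
      exact h.start i ε Ψ' ψ hψ
  · rintro ⟨h₁, h₂, h₃, h₄⟩
    refine ⟨?_, ?_, ?_, ?_⟩
    · rwa [InType, Tm.dsub_name]
    · intro i j ε ε' Ψ' ψ hi hj
      have := h₂ i j ε ε' Ψ' ψ (satisfies_two.2 ⟨hi, hj⟩)
      rwa [Tm.dwk_dsub] at this
    · intro i ε Ψ' ψ hi
      have := h₃ i ε Ψ' ψ (satisfies_one.2 hi)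
      rwa [Tm.dwk_dsub] at this
    · intro i ε Ψ' ψ hi
      exact h₄ i ε Ψ' ψ (satisfies_one.2 hi)

theorem compPrem_inType_self {n : ℕ} {rs : Fin (n + 1) → Dim Ψ} {r : Dim Ψ} {M : CTm Ψ}
    {N : Fin (n + 1) → Bool → Tm (Option Ψ) 0} (h₁ : ts.EqTm Ψ M M A)
    (h₂ : ts.TubesAdjacent rs N A) (h₃ : ts.CapMatches rs r N M A) :
    CompPrem (ts.InType A) rs r M M N N := by
  refine compPrem_inType_iff.2 ⟨h₁, h₂, fun i ε Ψ' ψ hψ => h₂ i i ε ε Ψ' ψ ?_, h₃⟩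
  rw [satisfies_one] at hψ
  exact satisfies_two.2 ⟨hψ, hψ⟩

theorem _root_.CubTT.CompPrem.conv {n : ℕ} {rs : Fin (n + 1) → Dim Ψ} {r : Dim Ψ} {M O : CTm Ψ}
    {N P : Fin (n + 1) → Bool → Tm (Option Ψ) 0} (h : CompPrem (ts.InType A) rs r M O N P)
    (hAB : ts.EqPretype Ψ A B) : CompPrem (ts.InType B) rs r M O N P :=
  h.mono fun _ ψ _ _ h => EqTm.conv h (hAB.dsub ψ)

/-! ### Equality of types -/

section Kan

variable {n : ℕ} {rs : Fin (n + 1) → Dim Ψ} {r : Dim Ψ} {M O : CTm Ψ}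
  {N P : Fin (n + 1) → Bool → Tm (Option Ψ) 0}

theorem EquallyKan.hcom (h : ts.EquallyKan Ψ A B) (r' : Dim Ψ)
    (hp : CompPrem (ts.InType A) rs r M O N P) :
    ts.EqTm Ψ (.hcom rs A r r' M N) (.hcom rs B r r' O P) A := by
  obtain ⟨h₁, h₂, h₃, h₄⟩ := compPrem_inType_iff.1 hp
  have := h.1 Ψ Dim.name n rs r r' M O N P
  simp only [Tm.dsub_name] at this
  exact this h₁ h₂ h₃ h₄

theorem EquallyKan.hcom_cap (h : ts.EquallyKan Ψ A B)
    (hp : CompPrem (ts.InType A) rs r M O N P) : ts.EqTm Ψ (.hcom rs A r r M N) M A := by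
  obtain ⟨h₁, h₂, -, h₄⟩ := compPrem_inType_iff.1 hp
  have := h.2.1 Ψ Dim.name n rs r M N
  simp only [Tm.dsub_name] at this
  exact this h₁.left h₂ h₄

theorem EquallyKan.hcom_tube (h : ts.EquallyKan Ψ A B) (r' : Dim Ψ)
    (hp : CompPrem (ts.InType A) rs r M O N P) {i : Fin (n + 1)} {ε : Bool}
    (hi : rs i = .const ε) : ts.EqTm Ψ (.hcom rs A r r' M N) ((N i ε).dinst r') A := by
  obtain ⟨h₁, h₂, -, h₄⟩ := compPrem_inType_iff.1 hp
  have := h.2.2.1 Ψ Dim.name n rs r r' M N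
  simp only [Tm.dsub_name] at this
  exact this h₁.left h₂ h₄ i ε hi

end Kan

theorem EquallyKan.dsub (h : ts.EquallyKan Ψ A B) {Ψ' : Ctx} (ψ : DSub Ψ Ψ') :
    ts.EquallyKan Ψ' (A.dsub ψ) (B.dsub ψ) := by
  obtain ⟨h₁, h₂, h₃, h₄, h₅⟩ := h
  refine ⟨?_, ?_, ?_, ?_, ?_⟩ <;> intro Ψ₂ φ <;> simp only [Tm.dsub_dsub]
  · exact h₁ Ψ₂ _
  · exact h₂ Ψ₂ _
  · exact h₃ Ψ₂ _
  · exact h₄ Ψ₂ _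
  · exact h₅ Ψ₂ _

/-- The cap, tube and identity-coercion laws are stated for `A` only. For `B` they follow by first
replacing the operation in `B` by that in `A`, using the binary laws. -/
theorem EquallyKan.symm (hAB : ts.EqPretype Ψ A B) (h : ts.EquallyKan Ψ A B) :
    ts.EquallyKan Ψ B A := by
  have hinst : ∀ {Ψ' : Ctx} (ψ : DSub Ψ (Option Ψ')) (r : Dim Ψ'),
      ts.EqPretype Ψ' ((A.dsub ψ).dinst r) ((B.dsub ψ).dinst r) := fun ψ r => by
    rw [Tm.dinst, Tm.dinst, Tm.dsub_dsub, Tm.dsub_dsub]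
    exact hAB.dsub _
  refine ⟨?_, ?_, ?_, ?_, ?_⟩
  · intro Ψ' ψ n rs r r' M O N P hM ha ht hc
    have hp := (compPrem_inType_iff.2 ⟨hM, ha, ht, hc⟩).conv (hAB.symm.dsub ψ)
    exact (((h.dsub ψ).hcom r' (hp.symm (ts.stablePER_inType _))).symm).conv (hAB.dsub ψ)
  · intro Ψ' ψ n rs r M N hM ha hc
    have hp := (compPrem_inType_self hM ha hc).conv (hAB.symm.dsub ψ)
    exact (((h.dsub ψ).hcom r hp).symm.trans ((h.dsub ψ).hcom_cap hp)).conv (hAB.dsub ψ)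
  · intro Ψ' ψ n rs r r' M N hM ha hc i ε hi
    have hp := (compPrem_inType_self hM ha hc).conv (hAB.symm.dsub ψ)
    exact (((h.dsub ψ).hcom r' hp).symm.trans ((h.dsub ψ).hcom_tube r' hp hi)).conv (hAB.dsub ψ)
  · intro Ψ' ψ r r' M N hM
    exact (h.2.2.2.1 Ψ' ψ r r' N M (hM.symm.conv (hinst ψ r).symm)).symm.conv (hinst ψ r')
  · intro Ψ' ψ r M hM
    have hM' := hM.conv (hinst ψ r).symm
    exact ((h.2.2.2.1 Ψ' ψ r r M M hM').symm.trans (h.2.2.2.2 Ψ' ψ r M hM')).conv (hinst ψ r)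

theorem EquallyKan.trans (hAB : ts.EqPretype Ψ A B) (h : ts.EquallyKan Ψ A B)
    (h' : ts.EquallyKan Ψ B C) : ts.EquallyKan Ψ A C := by
  have hinst : ∀ {Ψ' : Ctx} (ψ : DSub Ψ (Option Ψ')) (r : Dim Ψ'),
      ts.EqPretype Ψ' ((A.dsub ψ).dinst r) ((B.dsub ψ).dinst r) := fun ψ r => by
    rw [Tm.dinst, Tm.dinst, Tm.dsub_dsub, Tm.dsub_dsub]
    exact hAB.dsub _
  refine ⟨?_, h.2.1, h.2.2.1, ?_, h.2.2.2.2⟩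
  · intro Ψ' ψ n rs r r' M O N P hM ha ht hc
    have hp := compPrem_inType_iff.2 ⟨hM, ha, ht, hc⟩
    exact ((h.dsub ψ).hcom r' (hp.left (ts.stablePER_inType _))).trans
      (((h'.dsub ψ).hcom r' (hp.conv (hAB.dsub ψ))).conv (hAB.symm.dsub ψ))
  · intro Ψ' ψ r r' M N hM
    exact (h.2.2.2.1 Ψ' ψ r r' M M hM.left).trans
      ((h'.2.2.2.1 Ψ' ψ r r' M N (hM.conv (hinst ψ r))).conv (hinst ψ r').symm)

theorem EqType.symm (h : ts.EqType Ψ A B) : ts.EqType Ψ B A :=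
  ⟨h.1.symm, h.2.2.1, h.2.1, h.2.2.2.symm h.1⟩

theorem EqType.trans (h : ts.EqType Ψ A B) (h' : ts.EqType Ψ B C) : ts.EqType Ψ A C :=
  ⟨h.1.trans h'.1, h.2.1, h'.2.2.1, h.2.2.2.trans h.1 h'.2.2.2⟩

/-- Coercion along equal lines of types. -/
theorem EqTm.coe_line {L L' : Tm (Option Ψ) 0}
    (hL : ∀ (Ψ' : Ctx) (ψ : DSub (Option Ψ) Ψ'), ts.EqType Ψ' (L.dsub ψ) (L'.dsub ψ))
    (r r' : Dim Ψ) {M N : CTm Ψ} (hM : ts.EqTm Ψ M N (L.dinst r)) :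
    ts.EqTm Ψ (.coe L r r' M) (.coe L' r r' N) (L.dinst r') ∧
      ts.EqTm Ψ (.coe L r r M) M (L.dinst r) := by
  -- The Kan conditions start from a type over a finite set of numbers, whereas the line lives over
  -- `Option Ψ`. It is renamed along a bijection with a set of `Ψ.card + 1` names and renamed back
  -- inside the coercion.
  have hcard : Fintype.card (Option Ψ) = Fintype.card (Finset.range (Ψ.card + 1)) := by simp
  let e : Option Ψ ≃ Finset.range (Ψ.card + 1) := Fintype.equivOfCardEq hcard
  let ψ : DSub (Option Ψ) (Finset.range (Ψ.card + 1)) := fun x => .name (e x)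
  let φ : DSub (Finset.range (Ψ.card + 1)) (Option Ψ) := fun x => .name (e.symm x)
  have hψφ : ψ.comp φ = Dim.name := by
    funext x
    simp [DSub.comp, Dim.sub, ψ, φ]
  have hid : ∀ K : Tm (Option Ψ) 0, (K.dsub ψ).dsub φ = K := fun K => by
    rw [Tm.dsub_dsub, hψφ, Tm.dsub_name]
  obtain ⟨-, -, -, -, -, -, h₄, h₅⟩ := hL _ ψ
  have h₄ := h₄ Ψ φ r r' M N
  have h₅ := h₅ Ψ φ r M
  rw [hid, hid] at h₄
  rw [hid] at h₅
  exact ⟨h₄ hM, h₅ hM.left⟩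

/-! ### Families of types over `bool` -/

section Families

variable {E E' : Tm Ψ 1}

theorem EqTypeOpen.dsub (h : ts.EqTypeOpen Ψ .bool E E') {Ψ' : Ctx} (ψ : DSub Ψ Ψ') :
    ts.EqTypeOpen Ψ' .bool (E.dsub ψ) (E'.dsub ψ) := by
  refine ⟨⟨h.1.1.dsub ψ, fun Ψ₂ φ N N' hN => ?_⟩, fun Ψ₂ φ N N' hN => ?_⟩
  · rw [Tm.dsub_dsub, Tm.dsub_dsub]; exact h.1.2 Ψ₂ _ N N' hN
  · rw [Tm.dsub_dsub, Tm.dsub_dsub]; exact h.2 Ψ₂ _ N N' hN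

theorem EqTypeOpen.inst (h : ts.EqTypeOpen Ψ .bool E E') {N N' : CTm Ψ}
    (hN : ts.EqTm Ψ N N' .bool) : ts.EqType Ψ (E.inst N) (E'.inst N') := by
  have := h.2 Ψ Dim.name N N' hN
  rwa [Tm.dsub_name, Tm.dsub_name] at this

theorem EqTypeOpen.symm (h : ts.EqTypeOpen Ψ .bool E E') : ts.EqTypeOpen Ψ .bool E' E :=
  ⟨⟨h.1.1, fun Ψ' ψ N N' hN => (h.2 Ψ' ψ N' N hN.symm).1.symm⟩,
    fun Ψ' ψ N N' hN => (h.2 Ψ' ψ N' N hN.symm).symm⟩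

/-- `E[N]` and `E[N']` are compared through `E'[N']`. -/
theorem EqTypeOpen.left (h : ts.EqTypeOpen Ψ .bool E E') : ts.EqTypeOpen Ψ .bool E E := by
  have hE : ∀ (Ψ' : Ctx) (ψ : DSub Ψ Ψ') (N N' : CTm Ψ'), ts.EqTm Ψ' N N' .bool →
      ts.EqType Ψ' ((E.dsub ψ).inst N) ((E.dsub ψ).inst N') := fun Ψ' ψ N N' hN =>
    (h.2 Ψ' ψ N N' hN).trans (h.2 Ψ' ψ N' N' hN.right).symm
  exact ⟨⟨h.1.1, fun Ψ' ψ N N' hN => (hE Ψ' ψ N N' hN).1⟩, hE⟩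

end Families

end CTS

/-- This is the case distinction made by the evaluation rules of compositions in `bool`: a least
non-name extent selects the tube rule. -/
theorem exists_firstConst {D : Type} {n : ℕ} (rs : Fin (n + 1) → Dim D) :
    (∀ i, (rs i).IsName) ∨ ∃ i ε, (∀ j < i, (rs j).IsName) ∧ rs i = .const ε := by
  by_cases h : ∀ i, (rs i).IsName
  · exact .inl h
  · push Not at h
    obtain ⟨i, hi, hmin⟩ := WellFounded.has_min (r := fun i j : Fin (n + 1) => i < j) wellFounded_lt
      {i | ¬ (rs i).IsName} h
    refine .inr ⟨i, ?_⟩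
    cases hri : rs i with
    | const ε => exact ⟨ε, fun j hj => by_contra fun hj' => hmin j hj' hj, rfl⟩
    | name x => exact absurd ⟨x, hri⟩ hi

namespace CTS

variable {ts : CTS} {Ψ : Ctx}

/-! ### Formation and introduction for `bool` -/

theorem HasBool.pretype (hb : ts.HasBool) (Ψ : Ctx) : ts.EqPretype Ψ .bool .bool := by
  intro Ψ₁ ψ₁ Ψ₂ ψ₂
  refine ⟨.bool, .bool, .bool, .bool, .bool, .bool, ⟨IsVal.bool.eval, IsVal.bool.eval,
    IsVal.bool.eval⟩, ⟨IsVal.bool.eval, IsVal.bool.eval, IsVal.bool.eval⟩, ?_⟩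
  intro x hx y hy
  simp only [List.mem_cons, List.not_mem_nil, or_false, or_self] at hx hy
  rw [hx, hy]; exact hb.1 Ψ₂

/-- `bool` evaluates only to itself, so the type of the aspects is fixed. The right-hand side is the
form in which `BoolClosed` reads its premises. -/
theorem HasBool.eqTm_iff (hb : ts.HasBool) {M N : CTm Ψ} :
    ts.EqTm Ψ M N .bool ↔ Coherent (fun Ψ₂ _ => ts.Φ Ψ₂ .bool) M N := by
  constructor
  · rintro ⟨-, h⟩
    refine h.mono fun Ψ₂ ψ V W ⟨A₀, hA₀, hΦ⟩ => ?_
    obtain rfl := hA₀.deterministic (IsVal.bool (D := Ψ₂)).eval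
    exact hΦ
  · exact fun h => ⟨hb.pretype Ψ, h.mono fun Ψ₂ ψ V W hΦ => ⟨.bool, IsVal.bool.eval, hΦ⟩⟩

theorem HasBool.eqTm_of_stable (hb : ts.HasBool) {V : (Ψ : Ctx) → CTm Ψ} (hV : ∀ Ψ, IsVal (V Ψ))
    (hst : ∀ {Ψ Ψ' : Ctx} (ψ : DSub Ψ Ψ'), (V Ψ).dsub ψ = V Ψ')
    (hΦ : ∀ Ψ, ts.Φ Ψ .bool (V Ψ) (V Ψ)) (Ψ : Ctx) : ts.EqTm Ψ (V Ψ) (V Ψ) .bool := by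
  rw [hb.eqTm_iff]
  intro Ψ₁ ψ₁ Ψ₂ ψ₂
  refine ⟨V Ψ₁, V Ψ₂, V Ψ₂, V Ψ₁, V Ψ₂, V Ψ₂, ?_, ?_, ?_⟩
  · simp only [hst]; exact ⟨(hV _).eval, (hV _).eval, (hV _).eval⟩
  · simp only [hst]; exact ⟨(hV _).eval, (hV _).eval, (hV _).eval⟩
  · intro x hx y hy
    simp only [List.mem_cons, List.not_mem_nil, or_false, or_self] at hx hy
    rw [hx, hy]; exact hΦ Ψ₂

theorem HasBool.tt (hb : ts.HasBool) (Ψ : Ctx) : ts.EqTm Ψ .tt .tt .bool :=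
  hb.eqTm_of_stable (V := fun _ => .tt) (fun _ => .tt) (fun _ => rfl) hb.2.1.1 Ψ

theorem HasBool.ff (hb : ts.HasBool) (Ψ : Ctx) : ts.EqTm Ψ .ff .ff .bool :=
  hb.eqTm_of_stable (V := fun _ => .ff) (fun _ => .ff) (fun _ => rfl) hb.2.1.2.1 Ψ

/-! ### The Kan operations of `bool` -/

/-- Equality of elements of `bool`, as a family over the instances of a context. -/
def EqBool (ts : CTS) {Ψ : Ctx} (Ψ' : Ctx) (_ : DSub Ψ Ψ') (M N : CTm Ψ') : Prop :=
  ts.EqTm Ψ' M N .bool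

theorem stablePER_eqBool (ts : CTS) (Ψ : Ctx) : StablePER (ts.EqBool (Ψ := Ψ)) :=
  ts.stablePER_inType .bool

section Kan

variable {n : ℕ} {rs : Fin (n + 1) → Dim Ψ} {r : Dim Ψ} {M O : CTm Ψ}
  {N P : Fin (n + 1) → Bool → Tm (Option Ψ) 0}

/-- A substitution may turn an extent before `i` into a constant, and evaluation then selects
another face `j`; adjacency makes the choice immaterial. -/
theorem eqTm_hcom_bool_tube (hp : CompPrem ts.EqBool rs r M O N P) (r' : Dim Ψ)
    {i : Fin (n + 1)} {ε : Bool} (hi : rs i = .const ε) :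
    ts.EqTm Ψ (.hcom rs .bool r r' M N) ((N i ε).dinst r') .bool := by
  have hi' : ∀ {Ψ' : Ctx} (ψ : DSub Ψ Ψ'), (rs i).sub ψ = .const ε := fun ψ => by rw [hi]; rfl
  refine .expand ?_ fun Ψ' ψ => ?_
  · have := hp.adj_dinst r' (hi' Dim.name) (hi' Dim.name)
    rwa [Tm.dsub_name] at this
  · rcases exists_firstConst (fun j => (rs j).sub ψ) with h | ⟨j, ε', hlt, hj⟩
    · exact absurd (h i) (not_isName_of_const (hi' ψ))
    · refine ⟨((N j ε').dinst r').dsub ψ, ?_, hp.adj_dinst r' hj (hi' ψ)⟩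
      rw [Tm.dinst_dsub]
      exact .single (.hcom_bool_tube _ _ _ _ _ j ε' hlt hj)

/-- An instance evaluates to the cap or, if an extent has become constant, to a tube face at `r`,
which matches the cap. -/
theorem eqTm_hcom_bool_cap (hp : CompPrem ts.EqBool rs r M O N P) :
    ts.EqTm Ψ (.hcom rs .bool r r M N) M .bool := by
  refine .expand (EqTm.left hp.cap) fun Ψ' ψ => ?_
  rcases exists_firstConst (fun j => (rs j).sub ψ) with h | ⟨j, ε', hlt, hj⟩
  · exact ⟨M.dsub ψ, .single (.hcom_bool_cap _ _ _ _ _ h rfl), (EqTm.left hp.cap).dsub ψ⟩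
  · refine ⟨((N j ε').dinst r).dsub ψ, ?_, hp.start j ε' Ψ' ψ hj⟩
    rw [Tm.dinst_dsub]
    exact .single (.hcom_bool_tube _ _ _ _ _ j ε' hlt hj)

theorem HasBool.hcom_val (hb : ts.HasBool) (hp : CompPrem ts.EqBool rs r M O N P) {r' : Dim Ψ}
    (hrs : ∀ i, (rs i).IsName) (hr : r ≠ r') :
    ts.Φ Ψ .bool (.hcom rs .bool r r' M N) (.hcom rs .bool r r' O P) := by
  choose xs hxs using hrs
  obtain rfl : rs = fun i => .name (xs i) := funext hxs
  refine hb.2.1.2.2 Ψ n xs r r' M O N P hr (hb.eqTm_iff.1 hp.cap) ?_ ?_ ?_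
  · intro i j ε ε' Ψ' ψ hψ
    rw [satisfies_two] at hψ
    exact hb.eqTm_iff.1 (hp.adj i j ε ε' Ψ' ψ hψ.1 hψ.2)
  · intro i ε Ψ' ψ hψ
    rw [satisfies_one] at hψ
    exact hb.eqTm_iff.1 (hp.tube i ε Ψ' ψ hψ)
  · intro i ε Ψ' ψ hψ
    rw [satisfies_one] at hψ
    exact hb.eqTm_iff.1 (hp.start i ε Ψ' ψ hψ)

/-- Equal compositions in `bool` are equal, unless they are values. -/
theorem eqTm_hcom_bool_of_not_val (hp : CompPrem ts.EqBool rs r M O N P) {r' : Dim Ψ}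
    (h : ¬ ((∀ i, (rs i).IsName) ∧ r ≠ r')) :
    ts.EqTm Ψ (.hcom rs .bool r r' M N) (.hcom rs .bool r r' O P) .bool := by
  have hp' := hp.symm (ts.stablePER_eqBool Ψ)
  rcases exists_firstConst rs with hrs | ⟨i, ε, -, hi⟩
  · obtain rfl : r = r' := by_contra fun hr => h ⟨hrs, hr⟩
    exact (eqTm_hcom_bool_cap hp).trans (EqTm.trans hp.cap (eqTm_hcom_bool_cap hp').symm)
  · refine (eqTm_hcom_bool_tube hp r' hi).trans (.trans ?_ (eqTm_hcom_bool_tube hp' r' hi).symm)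
    have := hp.tube_dinst (i := i) (ε := ε) (ψ := Dim.name) r' (by rw [hi]; rfl)
    rwa [Tm.dsub_name, Tm.dsub_name] at this

theorem HasBool.eqVal_hcom (hb : ts.HasBool) (hp : CompPrem ts.EqBool rs r M O N P) (r' : Dim Ψ) :
    ts.EqVal Ψ (.hcom rs .bool r r' M N) (.hcom rs .bool r r' O P) .bool := by
  by_cases h : (∀ i, (rs i).IsName) ∧ r ≠ r'
  · exact ⟨.bool, _, _, IsVal.bool.eval, (IsVal.hcom_bool _ _ _ _ _ h.1 h.2).eval,
      (IsVal.hcom_bool _ _ _ _ _ h.1 h.2).eval, hb.hcom_val hp h.1 h.2⟩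
  · exact (eqTm_hcom_bool_of_not_val hp h).eqVal

/-- A composition value stays a composition under substitution and its premises persist, so its
instances are self-related by `HasBool.eqVal_hcom`, even when they cease to be values. -/
theorem HasBool.stableVal_hcom (hb : ts.HasBool) (hp : CompPrem ts.EqBool rs r M O N P)
    (r' : Dim Ψ) : ts.StableVal Ψ (.hcom rs .bool r r' M N) .bool := by
  have hp' := hp.left (ts.stablePER_eqBool Ψ)
  by_cases h : (∀ i, (rs i).IsName) ∧ r ≠ r'
  · exact ⟨_, (IsVal.hcom_bool _ _ _ _ _ h.1 h.2).eval, fun Ψ' ψ =>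
      hb.eqVal_hcom (hp'.dsub (ts.stablePER_eqBool Ψ) ψ) (r'.sub ψ)⟩
  · exact (eqTm_hcom_bool_of_not_val hp' h).stableVal

theorem HasBool.eqTm_hcom (hb : ts.HasBool) (hp : CompPrem ts.EqBool rs r M O N P) (r' : Dim Ψ) :
    ts.EqTm Ψ (.hcom rs .bool r r' M N) (.hcom rs .bool r r' O P) .bool := by
  have hQ := ts.stablePER_eqBool Ψ
  exact .of_eqVal (hb.pretype Ψ) (fun Ψ' ψ => hb.eqVal_hcom (hp.dsub hQ ψ) (r'.sub ψ))
    (fun Ψ' ψ => hb.stableVal_hcom (hp.dsub hQ ψ) (r'.sub ψ))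
    (fun Ψ' ψ => hb.stableVal_hcom ((hp.symm hQ).dsub hQ ψ) (r'.sub ψ))

end Kan

theorem eqTm_coe_bool {M : CTm Ψ} (hM : ts.EqTm Ψ M M .bool) (r r' : Dim Ψ) :
    ts.EqTm Ψ (.coe .bool r r' M) M .bool :=
  .expand hM fun _ ψ => ⟨M.dsub ψ, .single (.coe_bool _ _ _), hM.dsub ψ⟩

theorem HasBool.equallyKan (hb : ts.HasBool) (Ψ : Ctx) : ts.EquallyKan Ψ .bool .bool := by
  refine ⟨?_, ?_, ?_, ?_, ?_⟩
  · intro Ψ' ψ n rs r r' M O N P hM ha ht hc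
    exact hb.eqTm_hcom (compPrem_inType_iff.2 ⟨hM, ha, ht, hc⟩) r'
  · intro Ψ' ψ n rs r M N hM ha hc
    exact eqTm_hcom_bool_cap (compPrem_inType_self hM ha hc)
  · intro Ψ' ψ n rs r r' M N hM ha hc i ε hi
    exact eqTm_hcom_bool_tube (compPrem_inType_self hM ha hc) r' hi
  · intro Ψ' ψ r r' M N hM
    exact (eqTm_coe_bool (EqTm.left hM) r r').trans
      (EqTm.trans hM (eqTm_coe_bool (EqTm.right hM) r r').symm)
  · intro Ψ' ψ r M hM
    exact eqTm_coe_bool hM r r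

theorem HasBool.eqTm_of_val (hb : ts.HasBool) {V W : CTm Ψ} (h : ts.Φ Ψ .bool V W) :
    ts.EqTm Ψ V W .bool := by
  -- Keeping `ts.Φ Ψ .bool` in the relation makes the premises of the third clause equations in
  -- `bool` again, to which the Kan condition applies.
  refine (hb.2.2 (fun Ψ V W => ts.Φ Ψ .bool V W ∧ ts.EqTm Ψ V W .bool) ?_ Ψ V W h).2
  refine ⟨fun Ψ => ⟨hb.2.1.1 Ψ, hb.tt Ψ⟩, fun Ψ => ⟨hb.2.1.2.1 Ψ, hb.ff Ψ⟩, ?_⟩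
  intro Ψ n xs r r' M O N P hr hM ha ht hc
  have key : ∀ {Ψ' : Ctx} {M N : CTm Ψ'},
      Coherent (fun Ψ₂ _ V W => ts.Φ Ψ₂ .bool V W ∧ ts.EqTm Ψ₂ V W .bool) M N →
        ts.EqTm Ψ' M N .bool := fun h => hb.eqTm_iff.2 (h.mono fun _ _ _ _ h => h.1)
  have hp : CompPrem ts.EqBool (fun i => .name (xs i)) r M O N P :=
    ⟨key hM, fun i j ε ε' Ψ' ψ hi hj => key (ha i j ε ε' Ψ' ψ (satisfies_two.2 ⟨hi, hj⟩)),
      fun i ε Ψ' ψ hi => key (ht i ε Ψ' ψ (satisfies_one.2 hi)),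
      fun i ε Ψ' ψ hi => key (hc i ε Ψ' ψ (satisfies_one.2 hi))⟩
  exact ⟨hb.hcom_val hp (fun i => ⟨xs i, rfl⟩) hr, hb.eqTm_hcom hp r'⟩

theorem HasBool.cubical (hb : ts.HasBool) (Ψ : Ctx) : ts.Cubical Ψ .bool := by
  intro Ψ' ψ A₀ M N hA₀ h
  obtain rfl := hA₀.deterministic (IsVal.bool (D := Ψ')).eval
  exact hb.eqTm_of_val h

end CTS

namespace Tm

/-! ### The composition computing an eliminator on a composition value -/

variable {D : Type} {n : ℕ}

/-- The line of types `z.A[hcom_bool^{rs}(r ⇝ z, M; y.N)/a]`. -/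
def ifLine (A : Tm D 1) (rs : Fin (n + 1) → Dim D) (r : Dim D) (M : Tm D 0)
    (N : Fin (n + 1) → Bool → Tm (Option D) 0) : Tm (Option D) 0 :=
  A.dwk.inst (.hcom (fun i => (rs i).wk) .bool r.wk (.name none) M.dwk
    (fun i ε => (N i ε).dwkUnder))

/-- The tube faces `y.coe^{y ⇝ r'}(if_A(N; T, F))` along `ifLine`. -/
def ifTube (A : Tm D 1) (rs : Fin (n + 1) → Dim D) (r r' : Dim D) (M : Tm D 0)
    (N : Fin (n + 1) → Bool → Tm (Option D) 0) (T F : Tm D 0) (i : Fin (n + 1)) (ε : Bool) :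
    Tm (Option D) 0 :=
  .coe (ifLine A rs r M N).dwkUnder (.name none) r'.wk (.ifb A.dwk (N i ε) T.dwk F.dwk)

/-- The contractum of `if_A(hcom_bool^{rs}(r ⇝ r', M; y.N); T, F)`. -/
def ifCom (A : Tm D 1) (rs : Fin (n + 1) → Dim D) (r r' : Dim D) (M : Tm D 0)
    (N : Fin (n + 1) → Bool → Tm (Option D) 0) (T F : Tm D 0) : Tm D 0 :=
  .hcom rs ((ifLine A rs r M N).dinst r') r r' (.coe (ifLine A rs r M N) r r' (.ifb A M T F))
    (ifTube A rs r r' M N T F)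

variable (A : Tm D 1) (rs : Fin (n + 1) → Dim D) (r r' : Dim D) (M : Tm D 0)
  (N : Fin (n + 1) → Bool → Tm (Option D) 0) (T F : Tm D 0)

theorem ifLine_dsub {Y : Type} (ψ : DSub (Option D) Y) :
    (ifLine A rs r M N).dsub ψ = (A.dsub (DSub.wk.comp ψ)).inst
      (.hcom (fun i => (rs i).sub (DSub.wk.comp ψ)) .bool (r.sub (DSub.wk.comp ψ)) (ψ none)
        (M.dsub (DSub.wk.comp ψ)) (fun i ε => (N i ε).dsub (DSub.wk.comp ψ).lift)) := by
  rw [ifLine, inst_dwk_dsub]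
  simp only [dsub, Dim.wk_sub, dwk_dsub, dwkUnder_dsub_lift]
  rfl

theorem ifLine_dinst (s : Dim D) :
    (ifLine A rs r M N).dinst s = A.inst (.hcom rs .bool r s M N) := by
  rw [dinst, ifLine_dsub, DSub.wk_comp_inst, DSub.lift_name]
  simp only [dsub_name, Dim.sub_name]
  rfl

theorem ifLine_dsub_lift {Y : Type} (ψ : DSub D Y) :
    (ifLine A rs r M N).dsub ψ.lift = ifLine (A.dsub ψ) (fun i => (rs i).sub ψ) (r.sub ψ)
      (M.dsub ψ) (fun i ε => (N i ε).dsub ψ.lift) := by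
  rw [ifLine_dsub, ifLine, DSub.wk_comp_lift]
  simp only [dwk, dwkUnder, Dim.wk, dsub_dsub, Dim.sub_sub, DSub.lift_comp]
  rfl

theorem ifTube_dsub (i : Fin (n + 1)) (ε : Bool) {Y : Type} (ψ : DSub (Option D) Y) :
    (ifTube A rs r r' M N T F i ε).dsub ψ =
      .coe (ifLine (A.dsub (DSub.wk.comp ψ)) (fun i => (rs i).sub (DSub.wk.comp ψ))
          (r.sub (DSub.wk.comp ψ)) (M.dsub (DSub.wk.comp ψ))
          (fun i ε => (N i ε).dsub (DSub.wk.comp ψ).lift))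
        (ψ none) (r'.sub (DSub.wk.comp ψ))
        (.ifb (A.dsub (DSub.wk.comp ψ)) ((N i ε).dsub ψ) (T.dsub (DSub.wk.comp ψ))
          (F.dsub (DSub.wk.comp ψ))) := by
  simp only [ifTube, dsub, dwkUnder_dsub_lift, Dim.wk_sub, dwk_dsub, ifLine_dsub_lift]
  rfl

theorem ifTube_dinst (i : Fin (n + 1)) (ε : Bool) (s : Dim D) :
    (ifTube A rs r r' M N T F i ε).dinst s =
      .coe (ifLine A rs r M N) s r' (.ifb A ((N i ε).dinst s) T F) := by
  rw [dinst, ifTube_dsub, DSub.wk_comp_inst, DSub.lift_name]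
  simp only [dsub_name, Dim.sub_name]
  rfl

theorem ifCom_dsub {Y : Type} (ψ : DSub D Y) :
    (ifCom A rs r r' M N T F).dsub ψ = ifCom (A.dsub ψ) (fun i => (rs i).sub ψ) (r.sub ψ)
      (r'.sub ψ) (M.dsub ψ) (fun i ε => (N i ε).dsub ψ.lift) (T.dsub ψ) (F.dsub ψ) := by
  simp only [ifCom, dsub, dinst_dsub, ifLine_dsub_lift]
  congr 1
  funext i ε
  rw [ifTube_dsub, DSub.wk_comp_lift, ifTube]
  simp only [dwk, dwkUnder, Dim.wk, dsub_dsub, Dim.sub_sub, DSub.lift_comp, ifLine_dsub_lift]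
  rfl

end Tm

open Tm

namespace CTS

variable {ts : CTS} {Ψ : Ctx}

/-! ### Elimination -/

theorem IfRespects.symm {M N : CTm Ψ} (hMN : ts.EqTm Ψ M N .bool) (hb : ts.HasBool)
    (h : ts.IfRespects Ψ M N) : ts.IfRespects Ψ N M := by
  intro A A' T T' F F' hA hT hF
  exact (h A' A T' T F' F hA.symm (hT.symm.conv (hA.inst (hb.tt Ψ)).1)
    (hF.symm.conv (hA.inst (hb.ff Ψ)).1)).symm.conv (hA.symm.inst hMN).1

theorem IfRespects.trans {M N O : CTm Ψ} (hMN : ts.EqTm Ψ M N .bool) (hb : ts.HasBool)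
    (h : ts.IfRespects Ψ M N) (h' : ts.IfRespects Ψ N O) : ts.IfRespects Ψ M O := by
  intro A A' T T' F F' hA hT hF
  exact (h A A' T T' F F' hA hT hF).trans ((h' A' A' T' T' F' F' hA.symm.left
    (hT.right.conv (hA.inst (hb.tt Ψ)).1) (hF.right.conv (hA.inst (hb.ff Ψ)).1)).conv
    (hA.inst hMN).1.symm)

/-- Equality of elements of `bool` that is respected by elimination, at all instances. -/
def IfEq (ts : CTS) {Ψ : Ctx} (Ψ' : Ctx) (_ : DSub Ψ Ψ') (M N : CTm Ψ') : Prop :=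
  ts.EqTm Ψ' M N .bool ∧
    ∀ (Ψ₂ : Ctx) (φ : DSub Ψ' Ψ₂), ts.IfRespects Ψ₂ (M.dsub φ) (N.dsub φ)

theorem HasBool.stablePER_ifEq (hb : ts.HasBool) (Ψ : Ctx) : StablePER (ts.IfEq (Ψ := Ψ)) where
  symm h := ⟨h.1.symm, fun Ψ₂ φ => (h.2 Ψ₂ φ).symm (h.1.dsub φ) hb⟩
  trans h h' := ⟨h.1.trans h'.1, fun Ψ₂ φ => (h.2 Ψ₂ φ).trans (h.1.dsub φ) hb (h'.2 Ψ₂ φ)⟩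
  dsub h _ φ := ⟨h.1.dsub φ, fun Ψ₂ χ => by
    rw [Tm.dsub_dsub, Tm.dsub_dsub]; exact h.2 Ψ₂ _⟩

theorem IfEq.ifRespects {Ψ₀ : Ctx} {ψ : DSub Ψ₀ Ψ} {M N : CTm Ψ} (h : ts.IfEq Ψ ψ M N) :
    ts.IfRespects Ψ M N := by
  have := h.2 Ψ Dim.name
  rwa [Tm.dsub_name, Tm.dsub_name] at this

/-! ### Elimination at compositions -/

section Hcom

variable {n : ℕ} {rs : Fin (n + 1) → Dim Ψ} {r : Dim Ψ} {M O : CTm Ψ}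
  {N P : Fin (n + 1) → Bool → Tm (Option Ψ) 0} {A A' : Tm Ψ 1} {T T' F F' : CTm Ψ}

/-- The fillers `h^z` on both sides are equal in `bool` at every instance, by the Kan condition of
`bool`, and the families send equal booleans to equal types. -/
theorem HasBool.eqType_ifLine (hb : ts.HasBool) (hA : ts.EqTypeOpen Ψ .bool A A')
    (hp : CompPrem ts.EqBool rs r M O N P) (Ψ' : Ctx) (ψ : DSub (Option Ψ) Ψ') :
    ts.EqType Ψ' ((ifLine A rs r M N).dsub ψ) ((ifLine A' rs r O P).dsub ψ) := by
  rw [ifLine_dsub, ifLine_dsub]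
  exact hA.2 Ψ' _ _ _ (hb.eqTm_hcom (hp.dsub (ts.stablePER_eqBool Ψ) _) _)

/-- Coercion of equal eliminators along `ifLine`. -/
theorem HasBool.coe_ifLine (hb : ts.HasBool) (hA : ts.EqTypeOpen Ψ .bool A A')
    (hT : ts.EqTm Ψ T T' (A.inst .tt)) (hF : ts.EqTm Ψ F F' (A.inst .ff))
    (hp : CompPrem ts.EqBool rs r M O N P) {X Y : CTm Ψ} (hXY : ts.IfRespects Ψ X Y)
    (s r' : Dim Ψ) (hX : ts.EqTm Ψ X (.hcom rs .bool r s M N) .bool) :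
    ts.EqTm Ψ (.coe (ifLine A rs r M N) s r' (.ifb A X T F))
        (.coe (ifLine A' rs r O P) s r' (.ifb A' Y T' F')) (A.inst (.hcom rs .bool r r' M N)) ∧
      ts.EqTm Ψ (.coe (ifLine A rs r M N) s s (.ifb A X T F)) (.ifb A X T F)
        (A.inst (.hcom rs .bool r s M N)) := by
  have h : ts.EqTm Ψ (.ifb A X T F) (.ifb A' Y T' F') ((ifLine A rs r M N).dinst s) := by
    rw [ifLine_dinst]
    exact (hXY A A' T T' F F' hA hT hF).conv (hA.left.inst hX).1
  have := EqTm.coe_line (hb.eqType_ifLine hA hp) s r' h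
  rwa [ifLine_dinst, ifLine_dinst] at this

theorem _root_.CubTT.CompPrem.eqBool (hp : CompPrem ts.IfEq rs r M O N P) :
    CompPrem ts.EqBool rs r M O N P :=
  hp.mono fun _ _ _ _ h => h.1

/-- The premises of the composition `ifCom`. -/
theorem HasBool.compPrem_ifCom (hb : ts.HasBool) (hA : ts.EqTypeOpen Ψ .bool A A')
    (hT : ts.EqTm Ψ T T' (A.inst .tt)) (hF : ts.EqTm Ψ F F' (A.inst .ff))
    (hp : CompPrem ts.IfEq rs r M O N P) (r' : Dim Ψ) :
    CompPrem (ts.InType (A.inst (.hcom rs .bool r r' M N))) rs r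
      (.coe (ifLine A rs r M N) r r' (.ifb A M T F))
      (.coe (ifLine A' rs r O P) r r' (.ifb A' O T' F'))
      (ifTube A rs r r' M N T F) (ifTube A' rs r r' O P T' F') := by
  have hQ := hb.stablePER_ifEq Ψ
  -- Where `rs i = ε`, the face `N i ε` at `y` equals the filler from `r` to `y`. So the eliminator
  -- at this face lies in the fibre of `ifLine` at `y`, from which the tube coerces.
  have hside : ∀ {Ψ' : Ctx} (ψ : DSub (Option Ψ) Ψ') {i : Fin (n + 1)} {ε : Bool},
      (rs i).wk.sub ψ = .const ε →
      ts.EqTm Ψ' ((N i ε).dsub ψ) (.hcom (fun i => (rs i).sub (DSub.wk.comp ψ)) .bool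
        (r.sub (DSub.wk.comp ψ)) (ψ none) (M.dsub (DSub.wk.comp ψ))
        (fun i ε => (N i ε).dsub (DSub.wk.comp ψ).lift)) .bool := by
    intro Ψ' ψ i ε hi
    have := eqTm_hcom_bool_tube (hp.eqBool.dsub (ts.stablePER_eqBool Ψ) (DSub.wk.comp ψ)) (ψ none)
      (i := i) (ε := ε) (by rwa [← Dim.wk_sub])
    rw [dsub_lift_dinst] at this
    exact this.symm
  refine ⟨?_, ?_, ?_, ?_⟩
  · rw [InType, dsub_name]
    exact (hb.coe_ifLine hA hT hF hp.eqBool hp.cap.ifRespects r r'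
      (eqTm_hcom_bool_cap hp.eqBool).symm).1
  · intro i j ε ε' Ψ' ψ hi hj
    rw [ifTube_dsub, ifTube_dsub, InType, inst_dsub]
    have hT' := hT.left.dsub (DSub.wk.comp ψ)
    have hF' := hF.left.dsub (DSub.wk.comp ψ)
    rw [inst_dsub] at hT' hF'
    exact (hb.coe_ifLine (hA.left.dsub _) hT' hF'
      ((hp.left hQ).eqBool.dsub (ts.stablePER_eqBool Ψ) _)
      (hp.adj i j ε ε' Ψ' ψ hi hj).ifRespects (ψ none) _ (hside ψ hi)).1
  · intro i ε Ψ' ψ hi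
    rw [ifTube_dsub, ifTube_dsub, InType, inst_dsub]
    have hT' := hT.dsub (DSub.wk.comp ψ)
    have hF' := hF.dsub (DSub.wk.comp ψ)
    rw [inst_dsub] at hT' hF'
    exact (hb.coe_ifLine (hA.dsub _) hT' hF' (hp.eqBool.dsub (ts.stablePER_eqBool Ψ) _)
      (hp.tube i ε Ψ' ψ hi).ifRespects (ψ none) _ (hside ψ hi)).1
  -- At `y = r`, tube and cap are the same coercion from `r`, applied to eliminators at terms that
  -- the start condition makes equal.
  · intro i ε Ψ' ψ hi
    have hT' := hT.left.dsub ψ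
    have hF' := hF.left.dsub ψ
    rw [inst_dsub] at hT' hF'
    rw [ifTube_dinst, InType, inst_dsub]
    simp only [dsub, ifLine_dsub_lift, dinst_dsub]
    have hX := (eqTm_hcom_bool_tube (hp.eqBool.dsub (ts.stablePER_eqBool Ψ) ψ) (r.sub ψ) hi).symm
    have hXY := (hp.start i ε Ψ' ψ hi).ifRespects
    rw [dinst_dsub] at hXY
    exact (hb.coe_ifLine (hA.left.dsub ψ) hT' hF'
      ((hp.left hQ).eqBool.dsub (ts.stablePER_eqBool Ψ) ψ) hXY (r.sub ψ) _ hX).1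

/-- Instances of the contractum are equal to the eliminator at the term to which the instance of the
composition evaluates. -/
theorem HasBool.eqTm_ifb_hcom (hb : ts.HasBool) (hA : ts.EqTypeOpen Ψ .bool A A)
    (hT : ts.EqTm Ψ T T (A.inst .tt)) (hF : ts.EqTm Ψ F F (A.inst .ff))
    (hp : CompPrem ts.IfEq rs r M M N N) (r' : Dim Ψ) :
    ∃ Q, Relation.ReflTransGen Step (.ifb A (.hcom rs .bool r r' M N) T F) Q ∧
      ts.EqTm Ψ Q (ifCom A rs r r' M N T F) (A.inst (.hcom rs .bool r r' M N)) := by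
  have hp₀ : CompPrem ts.EqBool rs r M M N N := hp.eqBool
  have hK := (hA.inst (hb.eqTm_hcom hp₀ r')).2.2.2
  have hprem := hb.compPrem_ifCom hA hT hF hp r'
  rw [ifCom, ifLine_dinst]
  rcases exists_firstConst rs with hrs | ⟨i, ε, hlt, hi⟩
  · by_cases hr : r = r'
    · subst hr
      refine ⟨_, ifb_steps A T F (.single (.hcom_bool_cap _ _ _ _ _ hrs rfl)), ?_⟩
      -- The contractum equals its cap, a coercion over `r ⇝ r`, hence the eliminator at `M`.
      exact ((hK.hcom_cap hprem).trans (hb.coe_ifLine hA hT hF hp₀ hp.cap.ifRespects r r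
        (eqTm_hcom_bool_cap hp₀).symm).2).symm
    · refine ⟨_, .single (.if_hcom _ _ _ _ _ _ _ _ hrs hr), ?_⟩
      change ts.EqTm Ψ (ifCom A rs r r' M N T F) _ _
      rw [ifCom, ifLine_dinst]
      exact hK.hcom r' hprem
  · refine ⟨_, ifb_steps A T F (.single (.hcom_bool_tube _ _ _ _ _ i ε hlt hi)), ?_⟩
    -- The contractum equals its `i`-th face at `r'`, a coercion over `r' ⇝ r'`, hence the
    -- eliminator at that face of `N`.
    have h := hK.hcom_tube r' hprem hi
    rw [ifTube_dinst] at h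
    have hN := (hp.adj_dinst (ψ := Dim.name) r' (i := i) (j := i) (ε := ε) (ε' := ε)
      (by rw [hi]; rfl) (by rw [hi]; rfl)).ifRespects
    rw [dsub_name] at hN
    exact (h.trans (hb.coe_ifLine hA hT hF hp₀ hN r' r'
      (eqTm_hcom_bool_tube hp₀ r' hi).symm).2).symm

/-- The contractum commutes with substitution, so the previous lemma at each instance is what
coherent expansion requires. Its identity instance also shows that the contractum is well typed. -/
theorem HasBool.eqTm_ifb_hcom_ifCom (hb : ts.HasBool) (hA : ts.EqTypeOpen Ψ .bool A A)
    (hT : ts.EqTm Ψ T T (A.inst .tt)) (hF : ts.EqTm Ψ F F (A.inst .ff))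
    (hp : CompPrem ts.IfEq rs r M M N N) (r' : Dim Ψ) :
    ts.EqTm Ψ (.ifb A (.hcom rs .bool r r' M N) T F) (ifCom A rs r r' M N T F)
      (A.inst (.hcom rs .bool r r' M N)) := by
  obtain ⟨Q, -, hQ⟩ := hb.eqTm_ifb_hcom hA hT hF hp r'
  refine .expand hQ.right fun Ψ' ψ => ?_
  have hT' := hT.dsub ψ
  have hF' := hF.dsub ψ
  rw [inst_dsub] at hT' hF'
  rw [ifCom_dsub, inst_dsub]
  exact hb.eqTm_ifb_hcom (hA.dsub ψ) hT' hF' (hp.dsub (hb.stablePER_ifEq Ψ) ψ) (r'.sub ψ)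

/-- Both eliminators may be replaced by their contracta, which are compositions with equal data in
the equally Kan types `A[h]` and `A'[h']`. -/
theorem HasBool.ifRespects_hcom (hb : ts.HasBool) (hp : CompPrem ts.IfEq rs r M O N P)
    (r' : Dim Ψ) :
    ts.IfRespects Ψ (.hcom rs .bool r r' M N) (.hcom rs .bool r r' O P) := by
  intro A A' T T' F F' hA hT hF
  have hQ := hb.stablePER_ifEq Ψ
  have hp₀ : CompPrem ts.EqBool rs r M O N P := hp.eqBool
  have hh := hb.eqTm_hcom hp₀ r'
  have hAA' := hA.inst hh
  refine (hb.eqTm_ifb_hcom_ifCom hA.left hT.left hF.left (hp.left hQ) r').trans (.trans ?_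
    ((hb.eqTm_ifb_hcom_ifCom hA.symm.left (hT.right.conv (hA.inst (hb.tt Ψ)).1)
      (hF.right.conv (hA.inst (hb.ff Ψ)).1) (hp.right hQ) r').symm.conv hAA'.1.symm))
  have := hAA'.2.2.2.hcom r' (hb.compPrem_ifCom hA hT hF hp r')
  rw [← ifLine_dinst, ← ifLine_dinst] at this
  rw [← ifLine_dinst]
  exact this

end Hcom

/-! ### Computation, and elimination by induction on boolean values -/

theorem eqTm_ifb_tt {A : Tm Ψ 1} {T F : CTm Ψ} (hT : ts.EqTm Ψ T T (A.inst .tt)) :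
    ts.EqTm Ψ (.ifb A .tt T F) T (A.inst .tt) :=
  .expand hT fun _ ψ => ⟨T.dsub ψ, .single (.if_tt _ _ _), hT.dsub ψ⟩

theorem eqTm_ifb_ff {A : Tm Ψ 1} {T F : CTm Ψ} (hF : ts.EqTm Ψ F F (A.inst .ff)) :
    ts.EqTm Ψ (.ifb A .ff T F) F (A.inst .ff) :=
  .expand hF fun _ ψ => ⟨F.dsub ψ, .single (.if_ff _ _ _), hF.dsub ψ⟩

/-- Values of `bool` that are equal and respected by elimination. -/
def IfVal (ts : CTS) (Ψ : Ctx) (V W : CTm Ψ) : Prop :=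
  ts.Φ Ψ .bool V W ∧ ts.IfRespects Ψ V W

theorem HasBool.eqTm_of_ifVal (hb : ts.HasBool) {M N : CTm Ψ}
    (h : Coherent (fun Ψ₂ _ => ts.IfVal Ψ₂) M N) : ts.EqTm Ψ M N .bool :=
  hb.eqTm_iff.2 (h.mono fun _ _ _ _ h => h.1)

/-- The eliminators first evaluate their scrutinees, whose values are respected by elimination. A
boolean equals its value, so the result moves from `A[V]` to `A[M]`. -/
theorem HasBool.eqVal_ifb (hb : ts.HasBool) {M M' : CTm Ψ} {A A' : Tm Ψ 1} {T T' F F' : CTm Ψ}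
    (h : Coherent (fun Ψ₂ _ => ts.IfVal Ψ₂) M M') (hA : ts.EqTypeOpen Ψ .bool A A')
    (hT : ts.EqTm Ψ T T' (A.inst .tt)) (hF : ts.EqTm Ψ F F' (A.inst .ff)) :
    ts.EqVal Ψ (.ifb A M T F) (.ifb A' M' T' F') (A.inst M) := by
  obtain ⟨V, W, hV, hW, hVW, -⟩ := Coherent.eval h
  have hVM := (hb.eqTm_of_ifVal h).left.of_eval hV (hb.eqTm_of_val hVW.1).left
  exact ((hVW.2 A A' T T' F F' hA hT hF).conv (hA.left.inst hVM).1).eqVal.head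
    (ifb_steps A T F hV.1) (ifb_steps A' T' F' hW.1)

theorem HasBool.stableVal_ifb (hb : ts.HasBool) {M : CTm Ψ} {A : Tm Ψ 1} {T F : CTm Ψ}
    (h : Coherent (fun Ψ₂ _ => ts.IfVal Ψ₂) M M) (hA : ts.EqTypeOpen Ψ .bool A A)
    (hT : ts.EqTm Ψ T T (A.inst .tt)) (hF : ts.EqTm Ψ F F (A.inst .ff)) :
    ts.StableVal Ψ (.ifb A M T F) (A.inst M) := by
  obtain ⟨V, _, hV, -, -, hVV, hst⟩ := Coherent.eval h
  have hM := hb.eqTm_of_ifVal h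
  have hVM := hM.of_eval hV (hb.eqTm_of_val hVV.1)
  refine .head (hA.inst hM).1 (ifb_steps A T F hV.1)
    ((hVV.2 A A T T F F hA hT hF).conv (hA.inst hVM).1).stableVal fun Ψ' ψ => ?_
  -- The instances of `V` and of `M` have values `V₂` and `M'` related by `IfVal`, so the
  -- eliminators at these instances evaluate to related values.
  obtain ⟨V₂, W₂, M', N', hV₂, -, hM', -, hR⟩ := hst Ψ' ψ
  have hR := hR V₂ (by simp) M' (by simp)
  have hV₂M : ts.EqTm Ψ' V₂ (M.dsub ψ) .bool :=
    ((hVM.left.dsub ψ).of_eval hV₂ (hb.eqTm_of_val hR.1).left).trans (hVM.dsub ψ)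
  have hT' := hT.dsub ψ
  have hF' := hF.dsub ψ
  rw [inst_dsub] at hT' hF' ⊢
  exact ((hR.2 _ _ _ _ _ _ (hA.dsub ψ) hT' hF').conv ((hA.dsub ψ).inst hV₂M).1).eqVal.head
    (ifb_steps _ _ _ hV₂.1) (ifb_steps _ _ _ hM'.1)

/-- Elimination respects equality of terms if it respects equality of their aspects. -/
theorem HasBool.ifRespects_of_aspects (hb : ts.HasBool) {M M' : CTm Ψ}
    (h : Coherent (fun Ψ₂ _ => ts.IfVal Ψ₂) M M') : ts.IfRespects Ψ M M' := by
  intro A A' T T' F F' hA hT hF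
  have hM := hb.eqTm_of_ifVal h
  have ht : ∀ {N O P : CTm Ψ}, Coherent (fun Ψ₂ _ => ts.IfVal Ψ₂) N O →
      Coherent (fun Ψ₂ _ => ts.IfVal Ψ₂) O P → Coherent (fun Ψ₂ _ => ts.IfVal Ψ₂) N P :=
    Coherent.trans fun Ψ₂ _ {_ _ _} h h' => ⟨ts.Φ_trans (hb.1 Ψ₂) h.1 h'.1,
      h.2.trans (hb.eqTm_of_val h.1) hb h'.2⟩
  refine .of_eqVal (hA.left.inst hM.left).1 (fun Ψ' ψ => ?_) (fun Ψ' ψ => ?_) (fun Ψ' ψ => ?_)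
  · have hT' := hT.dsub ψ
    have hF' := hF.dsub ψ
    rw [inst_dsub] at hT' hF' ⊢
    exact hb.eqVal_ifb (h.dsub ψ) (hA.dsub ψ) hT' hF'
  · have hT' := hT.left.dsub ψ
    have hF' := hF.left.dsub ψ
    rw [inst_dsub] at hT' hF' ⊢
    exact hb.stableVal_ifb ((ht h h.symm).dsub ψ) (hA.left.dsub ψ) hT' hF'
  -- The right-hand side is stable in its own type `A'[M']`, which is then converted to `A[M]`.
  · have hT' := (hT.right.conv (hA.inst (hb.tt Ψ)).1).dsub ψ
    have hF' := (hF.right.conv (hA.inst (hb.ff Ψ)).1).dsub ψ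
    rw [inst_dsub] at hT' hF'
    have := (hb.stableVal_ifb ((ht h.symm h).dsub ψ) (hA.symm.left.dsub ψ) hT' hF').conv
      (((hA.dsub ψ).inst (hM.dsub ψ)).1.symm)
    rwa [← inst_dsub] at this

/-- Elimination respects equality of values. -/
theorem HasBool.ifRespects_val (hb : ts.HasBool) {V W : CTm Ψ} (h : ts.Φ Ψ .bool V W) :
    ts.IfRespects Ψ V W := by
  -- Induction on equality of values: the premises of the composition clause now assert elimination
  -- for all aspects, and `key` lifts this to the terms and their instances.
  refine (hb.2.2 ts.IfVal ?_ Ψ V W h).2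
  refine ⟨fun Ψ => ⟨hb.2.1.1 Ψ, ?_⟩, fun Ψ => ⟨hb.2.1.2.1 Ψ, ?_⟩, ?_⟩
  · intro A A' T T' F F' hA hT hF
    exact (eqTm_ifb_tt hT.left).trans (hT.trans
      ((eqTm_ifb_tt (hT.right.conv (hA.inst (hb.tt Ψ)).1)).symm.conv (hA.inst (hb.tt Ψ)).1.symm))
  · intro A A' T T' F F' hA hT hF
    exact (eqTm_ifb_ff hF.left).trans (hF.trans
      ((eqTm_ifb_ff (hF.right.conv (hA.inst (hb.ff Ψ)).1)).symm.conv (hA.inst (hb.ff Ψ)).1.symm))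
  · intro Ψ n xs r r' M O N P hr hM ha ht hc
    have key : ∀ {Ψ' : Ctx} {ψ : DSub Ψ Ψ'} {M N : CTm Ψ'},
        Coherent (fun Ψ₂ _ => ts.IfVal Ψ₂) M N → ts.IfEq Ψ' ψ M N := fun h =>
      ⟨hb.eqTm_of_ifVal h, fun Ψ₂ φ => hb.ifRespects_of_aspects (h.dsub φ)⟩
    have hp : CompPrem ts.IfEq (fun i => .name (xs i)) r M O N P :=
      ⟨key hM, fun i j ε ε' Ψ' ψ hi hj => key (ha i j ε ε' Ψ' ψ (satisfies_two.2 ⟨hi, hj⟩)),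
        fun i ε Ψ' ψ hi => key (ht i ε Ψ' ψ (satisfies_one.2 hi)),
        fun i ε Ψ' ψ hi => key (hc i ε Ψ' ψ (satisfies_one.2 hi))⟩
    exact ⟨hb.hcom_val hp.eqBool (fun i => ⟨xs i, rfl⟩) hr, hb.ifRespects_hcom hp r'⟩

/-- Elimination respects equality in `bool`. -/
theorem HasBool.ifRespects (hb : ts.HasBool) {M M' : CTm Ψ} (h : ts.EqTm Ψ M M' .bool) :
    ts.IfRespects Ψ M M' :=
  hb.ifRespects_of_aspects ((hb.eqTm_iff.1 h).mono fun _ _ _ _ h => ⟨h, hb.ifRespects_val h⟩)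

end CTS
end CubTT

open CubTT in
theorem mainTheorem4 (ts : CTS) (hbool : ts.HasBool) :
    -- Pretype
    (∀ Ψ : Ctx, ts.EqPretype Ψ .bool .bool) ∧
    -- Introduction
    (∀ Ψ : Ctx, ts.EqTm Ψ .tt .tt .bool) ∧
    (∀ Ψ : Ctx, ts.EqTm Ψ .ff .ff .bool) ∧
    -- Kan
    (∀ Ψ : Ctx, ts.EquallyKan Ψ .bool .bool) ∧
    -- Cubical
    (∀ Ψ : Ctx, ts.Cubical Ψ .bool) ∧
    -- Elimination
    (∀ (Ψ : Ctx) (M M' : CTm Ψ), ts.EqTm Ψ M M' .bool → ts.IfRespects Ψ M M') ∧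
    -- Elimination holds for equal elements if it holds for their aspects
    (∀ (Ψ : Ctx) (M M' : CTm Ψ), ts.EqTm Ψ M M' .bool →
      (∀ (Ψ₁ : Ctx) (ψ₁ : DSub Ψ Ψ₁) (Ψ₂ : Ctx) (ψ₂ : DSub Ψ₁ Ψ₂)
        (M₁ M₁' : CTm Ψ₁) (M₂ M₁₂ M₂' M₁₂' : CTm Ψ₂),
        Eval (M.dsub ψ₁) M₁ → Eval (M₁.dsub ψ₂) M₂ → Eval (M.dsub (ψ₁.comp ψ₂)) M₁₂ →
        Eval (M'.dsub ψ₁) M₁' → Eval (M₁'.dsub ψ₂) M₂' → Eval (M'.dsub (ψ₁.comp ψ₂)) M₁₂' →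
        RelFour (fun V V' => ts.EqTm Ψ₂ V V' .bool → ts.IfRespects Ψ₂ V V') M₂ M₁₂ M₂' M₁₂') →
      ts.IfRespects Ψ M M') ∧
    -- Elimination holds for equal values, including composition values
    (∀ (Ψ : Ctx) (V V' : CTm Ψ), ts.Φ Ψ .bool V V' → ts.IfRespects Ψ V V') ∧
    -- Computation
    (∀ (Ψ : Ctx) (A : Tm Ψ 1) (T F : CTm Ψ), ts.EqTypeOpen Ψ .bool A A →
      ts.EqTm Ψ T T (A.inst .tt) → ts.EqTm Ψ F F (A.inst .ff) →
      ts.EqTm Ψ (.ifb A .tt T F) T (A.inst .tt) ∧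
      ts.EqTm Ψ (.ifb A .ff T F) F (A.inst .ff)) := by
  refine ⟨hbool.pretype, hbool.tt, hbool.ff, hbool.equallyKan, hbool.cubical,
    fun Ψ M M' h => hbool.ifRespects h, fun Ψ M M' h _ => hbool.ifRespects h,
    fun Ψ V V' h => hbool.ifRespects_val h,
    fun Ψ A T F _ hT hF => ⟨CTS.eqTm_ifb_tt hT, CTS.eqTm_ifb_ff hF⟩⟩
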